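/- Let $M$ be a connected smooth $2$-manifold and let $x:M\to\mathbb R^3$ be a smooth immersion with a smooth unit normal field (Gauss map) $n:M\to S^2$. Let $K=\det S$ and $H=\tfrac12\operatorname{tr}S$ be the Gauss and mean curvatures, where $S=-(dx)^{-1}\circ dn$ is the shape operator; its eigenvalues are the principal curvatures. Assume that 1. (linear Weingarten) there are constants $(a,b,c)\in\mathbb R^3\setminus\{0\}$ such that $aK+2bH+c=0$ on $M$; 2. (non-tubular) no principal curvature is constant, that is, there is no $k\in\mathbb R$ which is a principal curvature of $x$ at every point of $M$; 3. (circular curvature lines) $M$ carries a smooth one-dimensional foliation whose leaves are curvature lines (everywhere tangent to eigenvectors of $S$) and such that every arc of a leaf is mapped by $x$ into a circle of $\mathbb R^3$ (of finite positive radius). Then $x$ is a surface of revolution, and the circles of the family are its parallels. That is, there are a point $o\in\mathbb R^3$ and an orthonormal basis $(f_0,f_1,f_2)$ of $\mathbb R^3$ such that near every point of $M$ there are smooth local coordinates $(u,\theta)$ and smooth functions $r>0$ and $h$ of $u$ with $$x(u,\theta)=o+r(u)\,(\cos\theta\, f_0+\sin\theta\, f_1)+h(u)\,f_2,$$ and every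 arc of a leaf of the foliation is mapped by $x$ into a circle whose centre lies on the axis $o+\mathbb R f_2$ and whose plane is orthogonal to $f_2$. -/

import Mathlib

open Set
open scoped Manifold ContDiff RealInnerProductSpace

noncomputable section

/-- Euclidean `3`-space. -/
abbrev E3 : Type := EuclideanSpace ℝ (Fin 3)

/-- The differential at `p` of a map `f : M → ℝ³` on a `2`-manifold, as a linear map
`T_p M → ℝ³`. -/
def differential {M : Type*} [TopologicalSpace M] [ChartedSpace (EuclideanSpace ℝ (Fin 2)) M]
    (f : M → E3) (p : M) : TangentSpace (𝓡 2) p →ₗ[ℝ] E3 :=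
  (mfderiv (𝓡 2) 𝓘(ℝ, E3) f p).toLinearMap

/-- A smooth surface in `ℝ³`: a smooth immersion `x : M → ℝ³` of a `2`-manifold together with a
smooth unit normal field (Gauss map) `n : M → ℝ³`. -/
structure SurfaceInSpace (M : Type*) [TopologicalSpace M]
    [ChartedSpace (EuclideanSpace ℝ (Fin 2)) M] where
  x : M → E3
  n : M → E3
  smooth_x : ContMDiff (𝓡 2) 𝓘(ℝ, E3) ∞ x
  smooth_n : ContMDiff (𝓡 2) 𝓘(ℝ, E3) ∞ n
  immersion : ∀ p, Function.Injective (differential x p)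
  unit_normal : ∀ p, ‖n p‖ = 1
  normal : ∀ p, ∀ X : TangentSpace (𝓡 2) p, ⟪n p, differential x p X⟫ = 0

namespace SurfaceInSpace

variable {M : Type*} [TopologicalSpace M] [ChartedSpace (EuclideanSpace ℝ (Fin 2)) M]

/-- The shape operator `S = -(dx)⁻¹ ∘ dn`; since `dn` takes values in the range of `dx`, it does
not depend on the left inverse of `dx`, see `differential_shapeOperator`. -/
def shapeOperator (s : SurfaceInSpace M) (p : M) : Module.End ℝ (TangentSpace (𝓡 2) p) :=
  -((differential s.x p).leftInverse ∘ₗ differential s.n p)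

/-- The Gauss curvature. -/
def gaussCurvature (s : SurfaceInSpace M) (p : M) : ℝ :=
  LinearMap.det (s.shapeOperator p)

/-- The mean curvature. -/
def meanCurvature (s : SurfaceInSpace M) (p : M) : ℝ :=
  LinearMap.trace ℝ (TangentSpace (𝓡 2) p) (s.shapeOperator p) / 2

/-- `k` is a principal curvature at `p`. -/
def IsPrincipalCurvature (s : SurfaceInSpace M) (p : M) (k : ℝ) : Prop :=
  (s.shapeOperator p).HasEigenvalue k

/-- A surface with a constant principal curvature (a tube, a developable surface or a totally
umbilic surface). -/
def IsTubular (s : SurfaceInSpace M) : Prop :=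
  ∃ k : ℝ, ∀ p, s.IsPrincipalCurvature p k

/-- The Gauss and mean curvatures satisfy a (nontrivial) relation `a K + 2 b H + c = 0` with
constant coefficients. -/
def IsLinearWeingarten (s : SurfaceInSpace M) : Prop :=
  ∃ a b c : ℝ, (a ≠ 0 ∨ b ≠ 0 ∨ c ≠ 0) ∧
    ∀ p, a * s.gaussCurvature p + 2 * b * s.meanCurvature p + c = 0

end SurfaceInSpace

/-- The circle with centre `m`, radius `r`, in the plane through `m` orthogonal to `τ`. -/
def circleInSpace (m τ : E3) (r : ℝ) : Set E3 :=
  {y | ‖y - m‖ = r ∧ ⟪y - m, τ⟫ = 0}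

section Foliations

variable {M : Type*} [TopologicalSpace M] [ChartedSpace (EuclideanSpace ℝ (Fin 2)) M]

/-- A `1`-dimensional smooth foliation of a `2`-manifold, given by the tangent lines `D p` of its
leaves: near every point there is a chart `(u, v)` such that the leaves are the lines
`u = const`, that is, `D = ker du`. -/
def IsFoliation (D : ∀ p : M, Submodule ℝ (TangentSpace (𝓡 2) p)) : Prop :=
  ∀ p : M, ∃ e ∈ IsManifold.maximalAtlas (𝓡 2) ∞ M, p ∈ e.source ∧
    ∀ q ∈ e.source, ∀ X : TangentSpace (𝓡 2) q,
      X ∈ D q ↔ mfderiv (𝓡 2) 𝓘(ℝ, ℝ) (fun q' => e q' 0) q X = (0 : ℝ)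

/-- `γ`, restricted to the open interval `(t₀, t₁)`, is a regular smooth parametrization of an arc
of a leaf of the foliation with tangent lines `D`. -/
def IsLeafArc (D : ∀ p : M, Submodule ℝ (TangentSpace (𝓡 2) p)) (γ : ℝ → M) (t₀ t₁ : ℝ) : Prop :=
  ContMDiffOn 𝓘(ℝ, ℝ) (𝓡 2) ∞ γ (Ioo t₀ t₁) ∧
    ∀ t ∈ Ioo t₀ t₁, mfderiv 𝓘(ℝ, ℝ) (𝓡 2) γ t (1 : ℝ) ≠ 0 ∧
      mfderiv 𝓘(ℝ, ℝ) (𝓡 2) γ t (1 : ℝ) ∈ D (γ t)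

/-- The foliation with tangent lines `D` is a family of circular curvature lines of `s`: its leaves
are tangent to principal directions and are mapped into circles of `ℝ³`
(of positive, finite radius). -/
structure IsCircularCurvatureLineFamily (s : SurfaceInSpace M)
    (D : ∀ p : M, Submodule ℝ (TangentSpace (𝓡 2) p)) : Prop where
  foliation : IsFoliation D
  curvatureLine : ∀ p, ∀ X ∈ D p, ∃ k : ℝ, s.shapeOperator p X = k • X
  circular : ∀ (γ : ℝ → M) (t₀ t₁ : ℝ), IsLeafArc D γ t₀ t₁ →
    ∃ (m τ : E3) (r : ℝ), ‖τ‖ = 1 ∧ 0 < r ∧ ∀ t ∈ Ioo t₀ t₁, s.x (γ t) ∈ circleInSpace m τ r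

/-- `s` is a surface of revolution with axis `o + ℝ f₂`, where `(f₀, f₁, f₂)` is an orthonormal
basis: near every point there are local coordinates `(u, θ)` on the surface in which
`x = o + r(u) (cos θ f₀ + sin θ f₁) + h(u) f₂`, with a smooth profile curve `(r, h)`, `r > 0`.
(The profile curve is automatically regular, as `x` is an immersion.) -/
def IsSurfaceOfRevolutionAbout (s : SurfaceInSpace M) (o : E3)
    (f : OrthonormalBasis (Fin 3) ℝ E3) : Prop :=
  ∀ p : M, ∃ e ∈ IsManifold.maximalAtlas (𝓡 2) ∞ M, p ∈ e.source ∧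
    ∃ (u₀ u₁ : ℝ) (r h : ℝ → ℝ),
      ContDiffOn ℝ ∞ r (Ioo u₀ u₁) ∧ ContDiffOn ℝ ∞ h (Ioo u₀ u₁) ∧
      (∀ u ∈ Ioo u₀ u₁, 0 < r u) ∧
      ∀ q ∈ e.source, e q 0 ∈ Ioo u₀ u₁ ∧
        s.x q = o + r (e q 0) • (Real.cos (e q 1) • f 0 + Real.sin (e q 1) • f 1)
          + h (e q 0) • f 2

end Foliations

namespace SurfaceInSpace

variable {M : Type*} [TopologicalSpace M] [ChartedSpace (EuclideanSpace ℝ (Fin 2)) M]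

theorem inner_differential_n (s : SurfaceInSpace M) (p : M) (X : TangentSpace (𝓡 2) p) :
    ⟪s.n p, differential s.n p X⟫ = 0 := by
  have hn : MDifferentiableAt (𝓡 2) 𝓘(ℝ, E3) s.n p :=
    (s.smooth_n p).mdifferentiableAt (by simp)
  have hg : MDifferentiableAt 𝓘(ℝ, E3) 𝓘(ℝ, ℝ) (fun y : E3 => ‖y‖ ^ 2) (s.n p) :=
    ((contDiff_norm_sq ℝ (E := E3) (n := 1)).differentiable (by simp) _).mdifferentiableAt
  have h1 := mfderiv_comp p hg hn
  have h2 : (fun y : E3 => ‖y‖ ^ 2) ∘ s.n = fun _ => (1 : ℝ) := by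
    funext q; simp [s.unit_normal q]
  rw [h2, mfderiv_const, mfderiv_eq_fderiv] at h1
  have h3 := DFunLike.congr_fun h1 X
  have h4 : fderiv ℝ (fun y : E3 => ‖y‖ ^ 2) (s.n p) = 2 • innerSL ℝ (s.n p) :=
    (hasStrictFDerivAt_norm_sq (s.n p)).hasFDerivAt.fderiv
  rw [h4] at h3
  have h5 : (0 : ℝ) = (2 • innerSL ℝ (s.n p)) (differential s.n p X) := h3
  simp at h5
  exact h5

theorem range_differential (s : SurfaceInSpace M) (p : M) :
    LinearMap.range (differential s.x p) = (ℝ ∙ s.n p)ᗮ := by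
  have hne : s.n p ≠ 0 := by
    intro h
    have := s.unit_normal p
    simp [h] at this
  have hf : Module.finrank ℝ E3 = 2 + 1 := by simp
  have : Fact (Module.finrank ℝ E3 = 2 + 1) := ⟨hf⟩
  have : Module.Finite ℝ (TangentSpace (𝓡 2) p) :=
    inferInstanceAs (Module.Finite ℝ (EuclideanSpace ℝ (Fin 2)))
  have hT : Module.finrank ℝ (TangentSpace (𝓡 2) p) = 2 :=
    (finrank_euclideanSpace_fin : Module.finrank ℝ (EuclideanSpace ℝ (Fin 2)) = 2)
  apply Submodule.eq_of_le_of_finrank_eq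
  · rintro _ ⟨X, rfl⟩
    exact Submodule.mem_orthogonal_singleton_iff_inner_right.2 (s.normal p X)
  · rw [Submodule.finrank_orthogonal_span_singleton (n := 2) hne,
      LinearMap.finrank_range_of_inj (s.immersion p), hT]

/-- The defining property of the shape operator: `dx ∘ S = -dn`. -/
theorem differential_shapeOperator (s : SurfaceInSpace M) (p : M) (X : TangentSpace (𝓡 2) p) :
    differential s.x p (s.shapeOperator p X) = -differential s.n p X := by
  have hmem : differential s.n p X ∈ LinearMap.range (differential s.x p) := by
    rw [range_differential]
    exact Submodule.mem_orthogonal_singleton_iff_inner_right.2 (s.inner_differential_n p X)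
  obtain ⟨Y, hY⟩ := hmem
  have hk : LinearMap.ker (differential s.x p) = ⊥ := LinearMap.ker_eq_bot.2 (s.immersion p)
  have : s.shapeOperator p X = -Y := by
    simp only [shapeOperator, LinearMap.neg_apply, LinearMap.comp_apply, ← hY]
    rw [LinearMap.leftInverse_apply_of_inj hk]
  rw [this, map_neg, hY]

end SurfaceInSpace

end

/-! Write `κ` for the principal curvature along the circles and `λ` for the other one. Take a
principal frame `a`, `b` with `a` tangent to the circles, put `A = dX a`, `B = dX b`, and let `g =
⟪D_a A, B⟫` be the geodesic curvature of the circles. By Joachimsthal, the normal along a circular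
curvature line makes a constant angle with the plane of the circle, so `κ` is constant along it
(`of_circle`).

If `α κ + β` vanished at one point, the Weingarten polynomial would factor and make that value of
`κ` a principal curvature everywhere, so the surface would be tubular (`add_ne_zero`). Hence `λ` is
a function of `κ` and is also constant along the circles. At an umbilic with curvature `k`, Codazzi
turns into a homogeneous linear equation for `κ - k`; unique continuation and connectedness would
give `κ = k` on all of `M`, again excluded (`normalCurvature_eq_of_umbilic`, `isRotational`).

Without umbilics, Codazzi makes the curves orthogonal to the circles geodesics, and commuting
derivatives shows that `g` is constant along each circle. The curvature vector of a circle is `V = g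
B + κ N`, its radius `r` satisfies `r² (g² + κ²) = 1`, and its axis is spanned by `w = r (κ B - g
N)`. The Codazzi and Gauss equations give `dw = 0`, and the centre `X + r² V` moves only in the
direction `w`. So nearby circles are coaxial.

The axis is determined, up to the sign of `w` and a translation along it, by any open piece of the
surface, so the local axes agree on the connected `M` (`exists_axis`). Finally distance to the axis
and height depend only on the coordinate `u` of a foliation chart `(u, v)`, and replacing `v` by the
polar angle gives the coordinates of a surface of revolution. -/

/-! ### Calculus of directional derivatives. -/

section DirectionalDerivative

variable {E F G : Type*} [NormedAddCommGroup E] [NormedSpace ℝ E] [NormedAddCommGroup F]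
  [NormedSpace ℝ F] [NormedAddCommGroup G] [InnerProductSpace ℝ G] {U : Set E} {z : E}

/-- The derivative of `f` along the vector field `a`. -/
noncomputable def dirDeriv (a : E → E) (f : E → F) : E → F := fun z => fderiv ℝ f z (a z)

theorem ContDiffOn.differentiableAt_of_isOpen {f : E → F} (hf : ContDiffOn ℝ ∞ f U)
    (hU : IsOpen U) (hz : z ∈ U) : DifferentiableAt ℝ f z :=
  (hf.contDiffAt (hU.mem_nhds hz)).differentiableAt (by simp)

theorem ContDiffOn.dirDeriv {a : E → E} {f : E → F} (hf : ContDiffOn ℝ ∞ f U) (hU : IsOpen U)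
    (ha : ContDiffOn ℝ ∞ a U) : ContDiffOn ℝ ∞ (dirDeriv a f) U :=
  (hf.fderiv_of_isOpen hU (by simp)).clm_apply ha

theorem dirDeriv_inner (a : E → E) {f g : E → G} (hf : DifferentiableAt ℝ f z)
    (hg : DifferentiableAt ℝ g z) :
    dirDeriv a (fun y => ⟪f y, g y⟫) z = ⟪f z, dirDeriv a g z⟫ + ⟪dirDeriv a f z, g z⟫ :=
  fderiv_inner_apply ℝ hf hg _

theorem dirDeriv_smul (a : E → E) {c : E → ℝ} {f : E → F} (hc : DifferentiableAt ℝ c z)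
    (hf : DifferentiableAt ℝ f z) :
    dirDeriv a (fun y => c y • f y) z = c z • dirDeriv a f z + dirDeriv a c z • f z := by
  simp [dirDeriv, fderiv_fun_smul hc hf]

theorem dirDeriv_mul (a : E → E) {c d : E → ℝ} (hc : DifferentiableAt ℝ c z)
    (hd : DifferentiableAt ℝ d z) :
    dirDeriv a (fun y => c y * d y) z = c z * dirDeriv a d z + dirDeriv a c z * d z :=
  dirDeriv_smul a hc hd

theorem dirDeriv_add (a : E → E) {f g : E → F} (hf : DifferentiableAt ℝ f z)
    (hg : DifferentiableAt ℝ g z) :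
    dirDeriv a (fun y => f y + g y) z = dirDeriv a f z + dirDeriv a g z := by
  simp [dirDeriv, fderiv_fun_add hf hg]

theorem dirDeriv_sub (a : E → E) {f g : E → F} (hf : DifferentiableAt ℝ f z)
    (hg : DifferentiableAt ℝ g z) :
    dirDeriv a (fun y => f y - g y) z = dirDeriv a f z - dirDeriv a g z := by
  simp [dirDeriv, fderiv_fun_sub hf hg]

theorem dirDeriv_neg (a : E → E) (f : E → F) :
    dirDeriv a (fun y => -f y) z = -dirDeriv a f z := by
  simp [dirDeriv, fderiv_fun_neg]

theorem dirDeriv_const (a : E → E) (c : F) : dirDeriv a (fun _ => c) z = 0 := by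
  simp [dirDeriv]

theorem dirDeriv_congr (a : E → E) {f g : E → F} (h : f =ᶠ[nhds z] g) :
    dirDeriv a f z = dirDeriv a g z := by
  simp [dirDeriv, h.fderiv_eq]

theorem dirDeriv_congr_of_isOpen (hU : IsOpen U) (a : E → E) {f g : E → F}
    (h : ∀ z ∈ U, f z = g z) (hz : z ∈ U) : dirDeriv a f z = dirDeriv a g z :=
  dirDeriv_congr a (Filter.eventually_of_mem (hU.mem_nhds hz) h)

theorem dirDeriv_eq_zero_of_isOpen (hU : IsOpen U) (a : E → E) {f : E → F} {c : F}
    (h : ∀ z ∈ U, f z = c) (hz : z ∈ U) : dirDeriv a f z = 0 :=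
  (dirDeriv_congr_of_isOpen hU a h hz).trans (dirDeriv_const a c)

/-- The commutator of two directional derivatives. -/
theorem dirDeriv_comm (hU : IsOpen U) {a b : E → E} {f : E → F} (ha : ContDiffOn ℝ ∞ a U)
    (hb : ContDiffOn ℝ ∞ b U) (hf : ContDiffOn ℝ ∞ f U) (hz : z ∈ U) :
    dirDeriv a (dirDeriv b f) z - dirDeriv b (dirDeriv a f) z =
      fderiv ℝ f z (dirDeriv a b z - dirDeriv b a z) := by
  have hf' : DifferentiableAt ℝ (fderiv ℝ f) z :=
    (hf.fderiv_of_isOpen hU (m := ∞) (by simp)).differentiableAt_of_isOpen hU hz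
  have key : ∀ {p q : E → E}, ContDiffOn ℝ ∞ q U → dirDeriv p (dirDeriv q f) z =
      fderiv ℝ f z (dirDeriv p q z) + fderiv ℝ (fderiv ℝ f) z (p z) (q z) := by
    intro p q hq
    have := fderiv_clm_apply hf' (hq.differentiableAt_of_isOpen hU hz)
    change fderiv ℝ (fun y => fderiv ℝ f y (q y)) z (p z) = _
    rw [this]
    simp [dirDeriv]
  have hs := (hf.contDiffAt (hU.mem_nhds hz)).isSymmSndFDerivAt
    (by simpa using WithTop.coe_le_coe.2 (le_top (a := (2 : ℕ∞)))) (a z) (b z)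
  rw [key hb, key ha, hs, map_sub]
  abel

end DirectionalDerivative

/-! ### Moving frames: structure equations and Codazzi equations. -/

theorem E3.eq_of_inner_eq {A B N w w' : E3} (hAA : ⟪A, A⟫ = 1) (hBB : ⟪B, B⟫ = 1)
    (hNN : ⟪N, N⟫ = 1) (hAB : ⟪A, B⟫ = 0) (hNA : ⟪N, A⟫ = 0) (hNB : ⟪N, B⟫ = 0)
    (hA : ⟪w, A⟫ = ⟪w', A⟫) (hB : ⟪w, B⟫ = ⟪w', B⟫) (hN : ⟪w, N⟫ = ⟪w', N⟫) : w = w' := by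
  have hBA := (real_inner_comm A B).trans hAB
  have hAN := (real_inner_comm N A).trans hNA
  have hBN := (real_inner_comm N B).trans hNB
  have ho : Orthonormal ℝ ![A, B, N] := by
    rw [orthonormal_iff_ite]
    intro i j
    fin_cases i <;> fin_cases j <;> simp_all
  have hs : ⊤ ≤ Submodule.span ℝ (range ![A, B, N]) :=
    (ho.linearIndependent.span_eq_top_of_card_eq_finrank (by simp)).ge
  refine InnerProductSpace.ext_inner_right_basis (𝕜 := ℝ) (OrthonormalBasis.mk ho hs).toBasis
    fun i => ?_
  fin_cases i <;> simpa

/-- `a`, `b` are vector fields on `U` such that `dX a`, `dX b` and the unit normal `N` form an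
orthonormal frame along the immersion `X`, and `a` is a principal direction. -/
structure IsPrincipalFrame {E : Type*} [NormedAddCommGroup E] [NormedSpace ℝ E] (U : Set E)
    (X N : E → E3) (a b : E → E) : Prop where
  isOpen : IsOpen U
  smooth_X : ContDiffOn ℝ ∞ X U
  smooth_N : ContDiffOn ℝ ∞ N U
  smooth_a : ContDiffOn ℝ ∞ a U
  smooth_b : ContDiffOn ℝ ∞ b U
  inner_N_N : ∀ z ∈ U, ⟪N z, N z⟫ = 1
  inner_N : ∀ z ∈ U, ∀ ξ, ⟪N z, fderiv ℝ X z ξ⟫ = 0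
  inner_a_a : ∀ z ∈ U, ⟪dirDeriv a X z, dirDeriv a X z⟫ = 1
  inner_b_b : ∀ z ∈ U, ⟪dirDeriv b X z, dirDeriv b X z⟫ = 1
  inner_a_b : ∀ z ∈ U, ⟪dirDeriv a X z, dirDeriv b X z⟫ = 0
  span : ∀ z ∈ U, ∀ ξ, ∃ s t : ℝ, ξ = s • a z + t • b z
  principal : ∀ z ∈ U, ∃ k : ℝ, dirDeriv a N z = k • dirDeriv a X z

section Curvature

variable {E : Type*} [NormedAddCommGroup E] [NormedSpace ℝ E]

/-- The normal curvature in the direction `a`. -/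
noncomputable def normalCurvature (X N : E → E3) (a : E → E) (z : E) : ℝ :=
  -⟪dirDeriv a N z, dirDeriv a X z⟫

/-- The coefficient `⟪D_c a, b⟫` of the connection in the frame `a, b`. -/
noncomputable def connectionCoeff (X : E → E3) (a b c : E → E) (z : E) : ℝ :=
  ⟪dirDeriv c (dirDeriv a X) z, dirDeriv b X z⟫

end Curvature

namespace IsPrincipalFrame

variable {E : Type*} [NormedAddCommGroup E] [NormedSpace ℝ E] {U : Set E} {X N : E → E3}
  {a b : E → E} {z : E}

theorem smooth_A (hf : IsPrincipalFrame U X N a b) : ContDiffOn ℝ ∞ (dirDeriv a X) U :=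
  hf.smooth_X.dirDeriv hf.isOpen hf.smooth_a

theorem smooth_B (hf : IsPrincipalFrame U X N a b) : ContDiffOn ℝ ∞ (dirDeriv b X) U :=
  hf.smooth_X.dirDeriv hf.isOpen hf.smooth_b

theorem smooth_normalCurvature_a (hf : IsPrincipalFrame U X N a b) :
    ContDiffOn ℝ ∞ (normalCurvature X N a) U :=
  ((hf.smooth_N.dirDeriv hf.isOpen hf.smooth_a).inner ℝ hf.smooth_A).neg

theorem smooth_normalCurvature_b (hf : IsPrincipalFrame U X N a b) :
    ContDiffOn ℝ ∞ (normalCurvature X N b) U :=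
  ((hf.smooth_N.dirDeriv hf.isOpen hf.smooth_b).inner ℝ hf.smooth_B).neg

theorem smooth_connectionCoeff_a (hf : IsPrincipalFrame U X N a b) :
    ContDiffOn ℝ ∞ (connectionCoeff X a b a) U :=
  (hf.smooth_A.dirDeriv hf.isOpen hf.smooth_a).inner ℝ hf.smooth_B

theorem eq_of_inner_eq (hf : IsPrincipalFrame U X N a b) (hz : z ∈ U) {w w' : E3}
    (hA : ⟪w, dirDeriv a X z⟫ = ⟪w', dirDeriv a X z⟫)
    (hB : ⟪w, dirDeriv b X z⟫ = ⟪w', dirDeriv b X z⟫) (hN : ⟪w, N z⟫ = ⟪w', N z⟫) : w = w' :=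
  E3.eq_of_inner_eq (hf.inner_a_a z hz) (hf.inner_b_b z hz) (hf.inner_N_N z hz)
    (hf.inner_a_b z hz) (hf.inner_N z hz _) (hf.inner_N z hz _) hA hB hN

/-- Inner products of the frame vectors, in both orders. -/
theorem inner_frame (hf : IsPrincipalFrame U X N a b) (hz : z ∈ U) :
    (⟪dirDeriv a X z, dirDeriv a X z⟫ = 1 ∧ ⟪dirDeriv b X z, dirDeriv b X z⟫ = 1 ∧
      ⟪N z, N z⟫ = 1) ∧
    (⟪dirDeriv a X z, dirDeriv b X z⟫ = 0 ∧ ⟪dirDeriv b X z, dirDeriv a X z⟫ = 0 ∧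
      ⟪N z, dirDeriv a X z⟫ = 0) ∧
    (⟪dirDeriv a X z, N z⟫ = 0 ∧ ⟪N z, dirDeriv b X z⟫ = 0 ∧ ⟪dirDeriv b X z, N z⟫ = 0) := by
  have h1 := hf.inner_a_b z hz
  have h2 : ⟪N z, dirDeriv a X z⟫ = 0 := hf.inner_N z hz _
  have h3 : ⟪N z, dirDeriv b X z⟫ = 0 := hf.inner_N z hz _
  refine ⟨⟨hf.inner_a_a z hz, hf.inner_b_b z hz, hf.inner_N_N z hz⟩, ⟨h1, ?_, h2⟩, ?_, h3, ?_⟩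
  all_goals rw [real_inner_comm]; assumption

/-- Product rule for a constant inner product; it makes the connection matrix of the orthonormal
frame skew-symmetric. -/
theorem inner_dirDeriv_of_const (hU : IsOpen U) (c : E → E) {f g : E → E3} {C : ℝ}
    (hf : ContDiffOn ℝ ∞ f U) (hg : ContDiffOn ℝ ∞ g U) (h : ∀ z ∈ U, ⟪f z, g z⟫ = C)
    (hz : z ∈ U) : ⟪dirDeriv c f z, g z⟫ = -⟪dirDeriv c g z, f z⟫ := by
  have h1 := dirDeriv_inner c (hf.differentiableAt_of_isOpen hU hz)
    (hg.differentiableAt_of_isOpen hU hz)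
  rw [dirDeriv_eq_zero_of_isOpen hU c h hz, real_inner_comm] at h1
  linarith

theorem inner_dirDeriv_self (hU : IsOpen U) (c : E → E) {f : E → E3}
    (hf : ContDiffOn ℝ ∞ f U) (h : ∀ z ∈ U, ⟪f z, f z⟫ = 1) (hz : z ∈ U) :
    ⟪dirDeriv c f z, f z⟫ = 0 := by
  have := inner_dirDeriv_of_const hU c hf hf h hz
  linarith

theorem dirDeriv_a_N (hf : IsPrincipalFrame U X N a b) (hz : z ∈ U) :
    dirDeriv a N z = -normalCurvature X N a z • dirDeriv a X z := by
  obtain ⟨k, hk⟩ := hf.principal z hz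
  have : normalCurvature X N a z = -k := by
    rw [normalCurvature, hk, real_inner_smul_left, hf.inner_a_a z hz, mul_one]
  rw [this, hk, neg_neg]

/-- Symmetry of the second fundamental form: `D_a B - D_b A` is tangent, so `⟪D_b N, A⟫ = ⟪D_a N, B⟫
= 0`. Hence `b` is principal as soon as `a` is. -/
theorem dirDeriv_b_N (hf : IsPrincipalFrame U X N a b) (hz : z ∈ U) :
    dirDeriv b N z = -normalCurvature X N b z • dirDeriv b X z := by
  obtain ⟨⟨h1, h2, h3⟩, ⟨h4, h5, h6⟩, h7, h8, h9⟩ := hf.inner_frame hz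
  refine hf.eq_of_inner_eq hz ?_ ?_ ?_
  · have e1 := inner_dirDeriv_of_const hf.isOpen b hf.smooth_N hf.smooth_A
      (fun z hz => hf.inner_N z hz _) hz
    have e2 := inner_dirDeriv_of_const hf.isOpen a hf.smooth_N hf.smooth_B
      (fun z hz => hf.inner_N z hz _) hz
    have e3 := dirDeriv_comm hf.isOpen hf.smooth_a hf.smooth_b hf.smooth_X hz
    have e4 := hf.inner_N z hz (dirDeriv a b z - dirDeriv b a z)
    rw [← e3, inner_sub_right, real_inner_comm, real_inner_comm (dirDeriv b (dirDeriv a X) z)]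
      at e4
    rw [hf.dirDeriv_a_N hz] at e2
    simp only [inner_smul_left, h4, h5] at e2 ⊢
    simp at e2 ⊢
    linarith
  · rw [normalCurvature, neg_neg, real_inner_smul_left, h2, mul_one]
  · rw [inner_dirDeriv_self hf.isOpen b hf.smooth_N hf.inner_N_N hz, inner_smul_left, h9,
      mul_zero]

/-- With the three lemmas after it, these are the Darboux equations of the frame. The mixed
derivatives `D_b A` and `D_a B` have no normal part because the directions are principal. -/
theorem dirDeriv_a_A (hf : IsPrincipalFrame U X N a b) (hz : z ∈ U) :
    dirDeriv a (dirDeriv a X) z =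
      connectionCoeff X a b a z • dirDeriv b X z + normalCurvature X N a z • N z := by
  obtain ⟨⟨h1, h2, h3⟩, ⟨h4, h5, h6⟩, h7, h8, h9⟩ := hf.inner_frame hz
  refine hf.eq_of_inner_eq hz ?_ ?_ ?_ <;> simp only [inner_add_left, real_inner_smul_left, *]
  · simpa using inner_dirDeriv_self hf.isOpen a hf.smooth_A hf.inner_a_a hz
  · simp [connectionCoeff]
  · rw [inner_dirDeriv_of_const hf.isOpen a hf.smooth_A hf.smooth_N
      (fun z hz => (hf.inner_frame hz).2.2.1) hz, hf.dirDeriv_a_N hz, real_inner_smul_left, h1]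
    simp

theorem dirDeriv_b_A (hf : IsPrincipalFrame U X N a b) (hz : z ∈ U) :
    dirDeriv b (dirDeriv a X) z = connectionCoeff X a b b z • dirDeriv b X z := by
  obtain ⟨⟨h1, h2, h3⟩, ⟨h4, h5, h6⟩, h7, h8, h9⟩ := hf.inner_frame hz
  refine hf.eq_of_inner_eq hz ?_ ?_ ?_ <;> simp only [real_inner_smul_left, *]
  · simpa using inner_dirDeriv_self hf.isOpen b hf.smooth_A hf.inner_a_a hz
  · simp [connectionCoeff]
  · rw [inner_dirDeriv_of_const hf.isOpen b hf.smooth_A hf.smooth_N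
      (fun z hz => (hf.inner_frame hz).2.2.1) hz, hf.dirDeriv_b_N hz, real_inner_smul_left, h5]
    simp

theorem dirDeriv_a_B (hf : IsPrincipalFrame U X N a b) (hz : z ∈ U) :
    dirDeriv a (dirDeriv b X) z = -connectionCoeff X a b a z • dirDeriv a X z := by
  obtain ⟨⟨h1, h2, h3⟩, ⟨h4, h5, h6⟩, h7, h8, h9⟩ := hf.inner_frame hz
  refine hf.eq_of_inner_eq hz ?_ ?_ ?_ <;> simp only [real_inner_smul_left, *]
  · rw [inner_dirDeriv_of_const hf.isOpen a hf.smooth_B hf.smooth_A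
      (fun z hz => (hf.inner_frame hz).2.1.2.1) hz, connectionCoeff, mul_one]
  · simpa using inner_dirDeriv_self hf.isOpen a hf.smooth_B hf.inner_b_b hz
  · rw [inner_dirDeriv_of_const hf.isOpen a hf.smooth_B hf.smooth_N
      (fun z hz => (hf.inner_frame hz).2.2.2.2) hz, hf.dirDeriv_a_N hz, real_inner_smul_left, h4]
    simp

theorem dirDeriv_b_B (hf : IsPrincipalFrame U X N a b) (hz : z ∈ U) :
    dirDeriv b (dirDeriv b X) z =
      -connectionCoeff X a b b z • dirDeriv a X z + normalCurvature X N b z • N z := by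
  obtain ⟨⟨h1, h2, h3⟩, ⟨h4, h5, h6⟩, h7, h8, h9⟩ := hf.inner_frame hz
  refine hf.eq_of_inner_eq hz ?_ ?_ ?_ <;> simp only [inner_add_left, real_inner_smul_left, *]
  · rw [inner_dirDeriv_of_const hf.isOpen b hf.smooth_B hf.smooth_A
      (fun z hz => (hf.inner_frame hz).2.1.2.1) hz, connectionCoeff]
    ring
  · simpa using inner_dirDeriv_self hf.isOpen b hf.smooth_B hf.inner_b_b hz
  · rw [inner_dirDeriv_of_const hf.isOpen b hf.smooth_B hf.smooth_N
      (fun z hz => (hf.inner_frame hz).2.2.2.2) hz, hf.dirDeriv_b_N hz, real_inner_smul_left, h2]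
    simp

/-- The commutator of the derivatives along the frame fields. -/
theorem dirDeriv_comm_frame (hf : IsPrincipalFrame U X N a b) (hz : z ∈ U) {F : Type*}
    [NormedAddCommGroup F] [NormedSpace ℝ F] {f : E → F} (h : ContDiffOn ℝ ∞ f U) :
    dirDeriv a (dirDeriv b f) z - dirDeriv b (dirDeriv a f) z =
      -connectionCoeff X a b a z • dirDeriv a f z - connectionCoeff X a b b z • dirDeriv b f z := by
  obtain ⟨⟨h1, h2, h3⟩, ⟨h4, h5, h6⟩, h7, h8, h9⟩ := hf.inner_frame hz
  have e1 := dirDeriv_comm hf.isOpen hf.smooth_a hf.smooth_b hf.smooth_X hz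
  have e2 := dirDeriv_comm hf.isOpen hf.smooth_a hf.smooth_b h hz
  -- The components of the bracket `[a, b]` are found by applying the commutator to `X` itself and
  -- pairing with `A` and `B`.
  obtain ⟨s, t, hst⟩ := hf.span z hz (dirDeriv a b z - dirDeriv b a z)
  rw [hst, map_add, map_smul, map_smul, hf.dirDeriv_a_B hz, hf.dirDeriv_b_A hz] at e1
  change _ = s • dirDeriv a X z + t • dirDeriv b X z at e1
  have hs := congrArg (fun w => ⟪w, dirDeriv a X z⟫) e1
  have ht := congrArg (fun w => ⟪w, dirDeriv b X z⟫) e1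
  simp only [inner_sub_left, inner_add_left, real_inner_smul_left, h1, h2, h4, h5] at hs ht
  rw [e2, hst, map_add, map_smul, map_smul]
  change s • dirDeriv a f z + t • dirDeriv b f z = _
  rw [show s = -connectionCoeff X a b a z by linarith,
    show t = -connectionCoeff X a b b z by linarith, neg_smul (connectionCoeff X a b b z),
    sub_eq_add_neg]

/-- The Codazzi equations. -/
theorem codazzi (hf : IsPrincipalFrame U X N a b) (hz : z ∈ U) :
    dirDeriv b (normalCurvature X N a) z =
        connectionCoeff X a b a z * (normalCurvature X N a z - normalCurvature X N b z) ∧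
      dirDeriv a (normalCurvature X N b) z =
        connectionCoeff X a b b z * (normalCurvature X N a z - normalCurvature X N b z) := by
  obtain ⟨⟨h1, h2, h3⟩, ⟨h4, h5, h6⟩, h7, h8, h9⟩ := hf.inner_frame hz
  -- Mixed derivatives of `N`: the `A` and `B` components of the commutator identity are the two
  -- equations.
  have e := hf.dirDeriv_comm_frame hz hf.smooth_N
  rw [dirDeriv_congr_of_isOpen hf.isOpen a (fun z hz => hf.dirDeriv_b_N hz) hz,
    dirDeriv_congr_of_isOpen hf.isOpen b (fun z hz => hf.dirDeriv_a_N hz) hz,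
    dirDeriv_smul a (hf.smooth_normalCurvature_b.differentiableAt_of_isOpen hf.isOpen hz).fun_neg
      (hf.smooth_B.differentiableAt_of_isOpen hf.isOpen hz),
    dirDeriv_smul b (hf.smooth_normalCurvature_a.differentiableAt_of_isOpen hf.isOpen hz).fun_neg
      (hf.smooth_A.differentiableAt_of_isOpen hf.isOpen hz),
    dirDeriv_neg, dirDeriv_neg, hf.dirDeriv_a_B hz, hf.dirDeriv_b_A hz, hf.dirDeriv_a_N hz,
    hf.dirDeriv_b_N hz] at e
  have hA := congrArg (fun w => ⟪w, dirDeriv a X z⟫) e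
  have hB := congrArg (fun w => ⟪w, dirDeriv b X z⟫) e
  simp only [inner_sub_left, inner_add_left, real_inner_smul_left, h1, h2, h4, h5] at hA hB
  constructor <;> linarith

end IsPrincipalFrame

/-! ### Curvatures constant along the `a`-curves: local rotational symmetry. -/

namespace IsPrincipalFrame

variable {E : Type*} [NormedAddCommGroup E] [NormedSpace ℝ E] {U : Set E} {X N : E → E3}
  {a b : E → E} {z : E}

theorem fderiv_eq_zero (hf : IsPrincipalFrame U X N a b) (hz : z ∈ U) {F : Type*}
    [NormedAddCommGroup F] [NormedSpace ℝ F] {f : E → F} (ha : dirDeriv a f z = 0)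
    (hb : dirDeriv b f z = 0) : fderiv ℝ f z = 0 := by
  ext ξ
  obtain ⟨s, t, rfl⟩ := hf.span z hz ξ
  change fderiv ℝ f z (a z) = 0 at ha
  change fderiv ℝ f z (b z) = 0 at hb
  simp [ha, hb]

theorem eq_of_dirDeriv_eq_zero (hf : IsPrincipalFrame U X N a b) (hU : IsPreconnected U)
    {F : Type*} [NormedAddCommGroup F] [NormedSpace ℝ F] {f : E → F} (hfs : ContDiffOn ℝ ∞ f U)
    (ha : ∀ z ∈ U, dirDeriv a f z = 0) (hb : ∀ z ∈ U, dirDeriv b f z = 0) :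
    ∃ c, ∀ z ∈ U, f z = c :=
  hf.isOpen.exists_is_const_of_fderiv_eq_zero hU (hfs.differentiableOn (by simp))
    fun z hz => hf.fderiv_eq_zero hz (ha z hz) (hb z hz)

/-- Both principal curvatures are constant along the integral curves of `a`, there are no umbilics,
and the integral curves of `a` are nowhere straight. -/
structure IsRotational (U : Set E) (X N : E → E3) (a b : E → E) : Prop extends
    IsPrincipalFrame U X N a b where
  dirDeriv_normalCurvature_a : ∀ z ∈ U, dirDeriv a (normalCurvature X N a) z = 0
  dirDeriv_normalCurvature_b : ∀ z ∈ U, dirDeriv a (normalCurvature X N b) z = 0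
  normalCurvature_ne : ∀ z ∈ U, normalCurvature X N a z ≠ normalCurvature X N b z
  curvature_ne_zero : ∀ z ∈ U, dirDeriv a (dirDeriv a X) z ≠ 0

namespace IsRotational

/-- The second Codazzi equation reads `0 = ⟪D_b A, B⟫ (κ - λ)`. Consequently the `b`-curves are
geodesics. -/
theorem connectionCoeff_b (hf : IsRotational U X N a b) (hz : z ∈ U) :
    connectionCoeff X a b b z = 0 := by
  have h := (hf.codazzi hz).2
  rw [hf.dirDeriv_normalCurvature_b z hz, eq_comm, mul_eq_zero] at h
  exact h.resolve_right (sub_ne_zero.2 (hf.normalCurvature_ne z hz))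

/-- Apply the commutator to `κ`: since `κ` is constant along `a`, it leaves `D_a (D_b κ) = 0`, and
`D_b κ = g (κ - λ)` with `κ - λ` nonzero and constant along `a`. -/
theorem dirDeriv_a_connectionCoeff (hf : IsRotational U X N a b) (hz : z ∈ U) :
    dirDeriv a (connectionCoeff X a b a) z = 0 := by
  have e := hf.dirDeriv_comm_frame hz hf.smooth_normalCurvature_a
  have hκ := hf.smooth_normalCurvature_a.differentiableAt_of_isOpen hf.isOpen hz
  have hl := hf.smooth_normalCurvature_b.differentiableAt_of_isOpen hf.isOpen hz
  rw [dirDeriv_congr_of_isOpen hf.isOpen a (fun z hz => (hf.codazzi hz).1) hz,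
    dirDeriv_eq_zero_of_isOpen hf.isOpen b (fun z hz => hf.dirDeriv_normalCurvature_a z hz) hz,
    dirDeriv_mul a (hf.smooth_connectionCoeff_a.differentiableAt_of_isOpen hf.isOpen hz)
      (hκ.fun_sub hl), dirDeriv_sub a hκ hl, hf.dirDeriv_normalCurvature_a z hz,
    hf.dirDeriv_normalCurvature_b z hz, hf.connectionCoeff_b hz] at e
  simpa [sub_eq_zero, hf.normalCurvature_ne z hz] using e

/-- The commutator applied to `A`, where `D_b A = 0` because the `b`-curves are geodesics. -/
theorem dirDeriv_b_V (hf : IsRotational U X N a b) (hz : z ∈ U) :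
    dirDeriv b (dirDeriv a (dirDeriv a X)) z =
      connectionCoeff X a b a z • dirDeriv a (dirDeriv a X) z := by
  have e := hf.dirDeriv_comm_frame hz hf.smooth_A
  rw [dirDeriv_eq_zero_of_isOpen hf.isOpen a (c := 0) (fun z hz => by
    rw [hf.dirDeriv_b_A hz, hf.connectionCoeff_b hz, zero_smul]) hz,
    hf.connectionCoeff_b hz] at e
  simpa using e

theorem dirDeriv_a_V (hf : IsRotational U X N a b) (hz : z ∈ U) :
    dirDeriv a (dirDeriv a (dirDeriv a X)) z =
      -(connectionCoeff X a b a z ^ 2 + normalCurvature X N a z ^ 2) • dirDeriv a X z := by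
  have hg := hf.smooth_connectionCoeff_a.differentiableAt_of_isOpen hf.isOpen hz
  have hκ := hf.smooth_normalCurvature_a.differentiableAt_of_isOpen hf.isOpen hz
  have hB := hf.smooth_B.differentiableAt_of_isOpen hf.isOpen hz
  have hN := hf.smooth_N.differentiableAt_of_isOpen hf.isOpen hz
  rw [dirDeriv_congr_of_isOpen hf.isOpen a (fun z hz => hf.dirDeriv_a_A hz) hz,
    dirDeriv_add a (hg.fun_smul hB) (hκ.fun_smul hN), dirDeriv_smul a hg hB,
    dirDeriv_smul a hκ hN, hf.dirDeriv_a_connectionCoeff hz, hf.dirDeriv_normalCurvature_a z hz,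
    hf.dirDeriv_a_B hz, hf.dirDeriv_a_N hz]
  module

/-- The Gauss equation, obtained as the `B` component of `D_b V = g V` with `V = g B + κ N`. -/
theorem dirDeriv_b_connectionCoeff (hf : IsRotational U X N a b) (hz : z ∈ U) :
    dirDeriv b (connectionCoeff X a b a) z = connectionCoeff X a b a z ^ 2 +
      normalCurvature X N a z * normalCurvature X N b z := by
  obtain ⟨⟨h1, h2, h3⟩, ⟨h4, h5, h6⟩, h7, h8, h9⟩ := hf.inner_frame hz
  have hg := hf.smooth_connectionCoeff_a.differentiableAt_of_isOpen hf.isOpen hz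
  have hκ := hf.smooth_normalCurvature_a.differentiableAt_of_isOpen hf.isOpen hz
  have hB := hf.smooth_B.differentiableAt_of_isOpen hf.isOpen hz
  have hN := hf.smooth_N.differentiableAt_of_isOpen hf.isOpen hz
  have e := hf.dirDeriv_b_V hz
  rw [hf.dirDeriv_a_A hz, dirDeriv_congr_of_isOpen hf.isOpen b (fun z hz => hf.dirDeriv_a_A hz) hz,
    dirDeriv_add b (hg.fun_smul hB) (hκ.fun_smul hN), dirDeriv_smul b hg hB,
    dirDeriv_smul b hκ hN, hf.dirDeriv_b_B hz, hf.dirDeriv_b_N hz, hf.connectionCoeff_b hz] at e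
  have eB := congrArg (fun w => ⟪w, dirDeriv b X z⟫) e
  simp only [inner_add_left, real_inner_smul_left, h2, h8] at eB
  linarith

/-- The quantity is `|V|²`, the squared curvature of the `a`-curve in space. -/
theorem sq_pos (hf : IsRotational U X N a b) (hz : z ∈ U) :
    0 < connectionCoeff X a b a z ^ 2 + normalCurvature X N a z ^ 2 := by
  have h := hf.curvature_ne_zero z hz
  rw [hf.dirDeriv_a_A hz] at h
  by_contra! hle
  have h1 : connectionCoeff X a b a z = 0 := by
    nlinarith [sq_nonneg (normalCurvature X N a z), sq_nonneg (connectionCoeff X a b a z)]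
  have h2 : normalCurvature X N a z = 0 := by
    nlinarith [sq_nonneg (normalCurvature X N a z), sq_nonneg (connectionCoeff X a b a z)]
  exact h (by simp [h1, h2])

/-- The radius of the integral curve of `a` through `z`. -/
noncomputable def radius (X N : E → E3) (a b : E → E) (z : E) : ℝ :=
  (Real.sqrt (connectionCoeff X a b a z ^ 2 + normalCurvature X N a z ^ 2))⁻¹

theorem smooth_radius (hf : IsRotational U X N a b) : ContDiffOn ℝ ∞ (radius X N a b) U :=
  ((((hf.smooth_connectionCoeff_a.pow 2).add (hf.smooth_normalCurvature_a.pow 2)).sqrt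
    fun _ hz => (hf.sq_pos hz).ne').inv fun _ hz => (Real.sqrt_pos.2 (hf.sq_pos hz)).ne')

theorem radius_pos (hf : IsRotational U X N a b) (hz : z ∈ U) : 0 < radius X N a b z :=
  inv_pos.2 (Real.sqrt_pos.2 (hf.sq_pos hz))

theorem radius_sq (hf : IsRotational U X N a b) (hz : z ∈ U) :
    radius X N a b z ^ 2 * (connectionCoeff X a b a z ^ 2 + normalCurvature X N a z ^ 2) = 1 := by
  rw [radius, inv_pow, Real.sq_sqrt (hf.sq_pos hz).le, inv_mul_cancel₀ (hf.sq_pos hz).ne']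

/-- Differentiate `r² (g² + κ²) = 1`. Along `b`, Gauss and Codazzi combine to `g (g² + κ λ) + κ g (κ
- λ) = g (g² + κ²)`, so `λ` cancels. -/
theorem dirDeriv_radius (hf : IsRotational U X N a b) (hz : z ∈ U) :
    dirDeriv a (radius X N a b) z = 0 ∧
      dirDeriv b (radius X N a b) z = -connectionCoeff X a b a z * radius X N a b z := by
  have hg := hf.smooth_connectionCoeff_a.differentiableAt_of_isOpen hf.isOpen hz
  have hκ := hf.smooth_normalCurvature_a.differentiableAt_of_isOpen hf.isOpen hz
  have hr := hf.smooth_radius.differentiableAt_of_isOpen hf.isOpen hz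
  have hpos := hf.radius_pos hz
  have hsq := hf.radius_sq hz
  have key : ∀ c : E → E, (radius X N a b z * radius X N a b z) *
      (2 * connectionCoeff X a b a z * dirDeriv c (connectionCoeff X a b a) z +
        2 * normalCurvature X N a z * dirDeriv c (normalCurvature X N a) z) +
      2 * radius X N a b z * dirDeriv c (radius X N a b) z *
        (connectionCoeff X a b a z ^ 2 + normalCurvature X N a z ^ 2) = 0 := by
    intro c
    have e := dirDeriv_eq_zero_of_isOpen (f := fun y => (radius X N a b y * radius X N a b y) *
      (connectionCoeff X a b a y * connectionCoeff X a b a y +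
        normalCurvature X N a y * normalCurvature X N a y)) (c := 1) hf.isOpen c
      (fun z hz => by rw [← hf.radius_sq hz]; ring) hz
    rw [dirDeriv_mul c (hr.fun_mul hr) ((hg.fun_mul hg).fun_add (hκ.fun_mul hκ)),
      dirDeriv_add c (hg.fun_mul hg) (hκ.fun_mul hκ), dirDeriv_mul c hr hr, dirDeriv_mul c hg hg,
      dirDeriv_mul c hκ hκ] at e
    linarith
  have solve : ∀ x y : ℝ, 2 * radius X N a b z * x *
      (connectionCoeff X a b a z ^ 2 + normalCurvature X N a z ^ 2) = 2 * radius X N a b z * y *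
      (connectionCoeff X a b a z ^ 2 + normalCurvature X N a z ^ 2) → x = y := fun x y h =>
    mul_left_cancel₀ (by positivity) (mul_right_cancel₀ (hf.sq_pos hz).ne' h)
  have ka := key a
  have kb := key b
  rw [hf.dirDeriv_a_connectionCoeff hz, hf.dirDeriv_normalCurvature_a z hz] at ka
  rw [hf.dirDeriv_b_connectionCoeff hz, (hf.codazzi hz).1] at kb
  refine ⟨solve _ _ ?_, solve _ _ ?_⟩
  · linear_combination ka
  · linear_combination kb

/-- The unit vector spanning the axis of the integral curve of `a` through `z`. -/
noncomputable def axis (X N : E → E3) (a b : E → E) (z : E) : E3 :=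
  radius X N a b z • (normalCurvature X N a z • dirDeriv b X z - connectionCoeff X a b a z • N z)

/-- Along `a` the coefficients are constant and the terms from `D_a B = -g A` and `D_a N = -κ A`
cancel. Along `b` the Gauss and Codazzi terms cancel the change of the radius. -/
theorem exists_axis_eq (hf : IsRotational U X N a b) (hU : IsPreconnected U) :
    ∃ w, ∀ z ∈ U, axis X N a b z = w := by
  have hs : ContDiffOn ℝ ∞ (axis X N a b) U :=
    hf.smooth_radius.smul ((hf.smooth_normalCurvature_a.smul hf.smooth_B).sub
      (hf.smooth_connectionCoeff_a.smul hf.smooth_N))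
  have key : ∀ c : E → E, ∀ z ∈ U, dirDeriv c (axis X N a b) z =
      radius X N a b z • ((normalCurvature X N a z • dirDeriv c (dirDeriv b X) z +
        dirDeriv c (normalCurvature X N a) z • dirDeriv b X z) -
        (connectionCoeff X a b a z • dirDeriv c N z +
        dirDeriv c (connectionCoeff X a b a) z • N z)) + dirDeriv c (radius X N a b) z •
          (normalCurvature X N a z • dirDeriv b X z - connectionCoeff X a b a z • N z) := by
    intro c z hz
    have hg := hf.smooth_connectionCoeff_a.differentiableAt_of_isOpen hf.isOpen hz
    have hκ := hf.smooth_normalCurvature_a.differentiableAt_of_isOpen hf.isOpen hz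
    have hr := hf.smooth_radius.differentiableAt_of_isOpen hf.isOpen hz
    have hB := hf.smooth_B.differentiableAt_of_isOpen hf.isOpen hz
    have hN := hf.smooth_N.differentiableAt_of_isOpen hf.isOpen hz
    have e := dirDeriv_smul c hr ((hκ.fun_smul hB).fun_sub (hg.fun_smul hN))
    rw [dirDeriv_sub c (hκ.fun_smul hB) (hg.fun_smul hN), dirDeriv_smul c hκ hB,
      dirDeriv_smul c hg hN] at e
    exact e
  refine hf.eq_of_dirDeriv_eq_zero hU hs (fun z hz => ?_) fun z hz => ?_
  · rw [key a z hz, hf.dirDeriv_a_B hz, hf.dirDeriv_a_N hz, hf.dirDeriv_a_connectionCoeff hz,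
      hf.dirDeriv_normalCurvature_a z hz, (hf.dirDeriv_radius hz).1]
    module
  · rw [key b z hz, hf.dirDeriv_b_B hz, hf.dirDeriv_b_N hz, hf.dirDeriv_b_connectionCoeff hz,
      (hf.codazzi hz).1, (hf.dirDeriv_radius hz).2, hf.connectionCoeff_b hz]
    module

theorem inner_axis_self (hf : IsRotational U X N a b) (hz : z ∈ U) :
    ⟪axis X N a b z, axis X N a b z⟫ = 1 := by
  obtain ⟨⟨h1, h2, h3⟩, ⟨h4, h5, h6⟩, h7, h8, h9⟩ := hf.inner_frame hz
  simp only [axis, inner_sub_left, inner_sub_right, real_inner_smul_left, real_inner_smul_right,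
    h2, h3, h8, h9]
  linear_combination hf.radius_sq hz

/-- The centre of the integral curve of `a` through `z`. -/
noncomputable def centre (X N : E → E3) (a b : E → E) (z : E) : E3 :=
  X z + (radius X N a b z * radius X N a b z) • dirDeriv a (dirDeriv a X) z

theorem smooth_centre (hf : IsRotational U X N a b) : ContDiffOn ℝ ∞ (centre X N a b) U :=
  hf.smooth_X.add ((hf.smooth_radius.mul hf.smooth_radius).smul
    (hf.smooth_A.dirDeriv hf.isOpen hf.smooth_a))

/-- Along `a`, `D_a V = -|V|² A` and `r² |V|² = 1` cancel `A`. Along `b`, what remains is `B - r² g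
V = r κ w`. -/
theorem dirDeriv_centre (hf : IsRotational U X N a b) (hz : z ∈ U) :
    dirDeriv a (centre X N a b) z = 0 ∧ dirDeriv b (centre X N a b) z =
      (radius X N a b z * normalCurvature X N a z) • axis X N a b z := by
  have key : ∀ c : E → E, dirDeriv c (centre X N a b) z = dirDeriv c X z +
      ((radius X N a b z * radius X N a b z) • dirDeriv c (dirDeriv a (dirDeriv a X)) z +
      (radius X N a b z * dirDeriv c (radius X N a b) z +
        dirDeriv c (radius X N a b) z * radius X N a b z) • dirDeriv a (dirDeriv a X) z) := by
    intro c
    have hr := hf.smooth_radius.differentiableAt_of_isOpen hf.isOpen hz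
    have hX := hf.smooth_X.differentiableAt_of_isOpen hf.isOpen hz
    have hV := (hf.smooth_A.dirDeriv hf.isOpen hf.smooth_a).differentiableAt_of_isOpen hf.isOpen hz
    rw [← dirDeriv_mul c hr hr, ← dirDeriv_smul c (hr.fun_mul hr) hV,
      ← dirDeriv_add c hX ((hr.fun_mul hr).fun_smul hV)]
    rfl
  have hsq := hf.radius_sq hz
  constructor
  · rw [key, (hf.dirDeriv_radius hz).1, hf.dirDeriv_a_V hz]
    linear_combination (norm := module) (-hsq) • dirDeriv a X z
  · rw [key, (hf.dirDeriv_radius hz).2, hf.dirDeriv_b_V hz, hf.dirDeriv_a_A hz, axis]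
    linear_combination (norm := module) (-hsq) • dirDeriv b X z

/-- The axis is constant, and the centres of the integral curves of `a` lie on it. -/
theorem exists_axis_centre_eq (hf : IsRotational U X N a b) (hU : IsPreconnected U) (hne : U.Nonempty) :
    ∃ o w : E3, ‖w‖ = 1 ∧ ∀ z ∈ U, axis X N a b z = w ∧ ∃ t : ℝ, centre X N a b z = o + t • w := by
  obtain ⟨w, hw⟩ := hf.exists_axis_eq hU
  have hww : ⟪w, w⟫ = 1 := by
    obtain ⟨z, hz⟩ := hne
    rw [← hw z hz]
    exact hf.inner_axis_self hz
  -- The base point is the component of the centre orthogonal to `w`, which is constant because the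
  -- centre moves along `w`.
  obtain ⟨o, ho⟩ : ∃ o, ∀ z ∈ U, centre X N a b z - ⟪centre X N a b z, w⟫ • w = o := by
    have key : ∀ c : E → E, ∀ z ∈ U,
        dirDeriv c (fun z => centre X N a b z - ⟪centre X N a b z, w⟫ • w) z =
          dirDeriv c (centre X N a b) z - ⟪dirDeriv c (centre X N a b) z, w⟫ • w := by
      intro c z hz
      have hc := hf.smooth_centre.differentiableAt_of_isOpen hf.isOpen hz
      have hi : DifferentiableAt ℝ (fun z => ⟪centre X N a b z, w⟫) z :=
        hc.inner ℝ (differentiableAt_const w)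
      rw [dirDeriv_sub c hc (hi.fun_smul (differentiableAt_const w)),
        dirDeriv_smul c hi (differentiableAt_const w),
        dirDeriv_inner c hc (differentiableAt_const w), dirDeriv_const]
      simp
    refine hf.eq_of_dirDeriv_eq_zero hU ?_ (fun z hz => ?_) fun z hz => ?_
    · exact hf.smooth_centre.sub
        ((hf.smooth_centre.inner ℝ contDiffOn_const).smul contDiffOn_const)
    · simp [key a z hz, (hf.dirDeriv_centre hz).1]
    · rw [key b z hz, (hf.dirDeriv_centre hz).2, hw z hz, real_inner_smul_left, hww, mul_one,
        sub_self]
  refine ⟨o, w, ?_, fun z hz => ⟨hw z hz, ⟪centre X N a b z, w⟫, ?_⟩⟩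
  · rw [norm_eq_sqrt_real_inner, hww, Real.sqrt_one]
  · rw [← ho z hz, sub_add_cancel]

/-- `A`, `V` and the axis vector are an orthogonal basis; this is what makes the axis unique. -/
theorem eq_inner_axis_smul (hf : IsRotational U X N a b) (hz : z ∈ U) {y : E3}
    (hA : ⟪y, dirDeriv a X z⟫ = 0) (hV : ⟪y, dirDeriv a (dirDeriv a X) z⟫ = 0) :
    y = ⟪y, axis X N a b z⟫ • axis X N a b z := by
  obtain ⟨⟨h1, h2, h3⟩, ⟨h4, h5, h6⟩, h7, h8, h9⟩ := hf.inner_frame hz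
  have hsq := hf.radius_sq hz
  rw [hf.dirDeriv_a_A hz] at hV
  simp only [inner_add_right, real_inner_smul_right] at hV
  refine hf.eq_of_inner_eq hz ?_ ?_ ?_ <;>
    simp only [axis, inner_sub_left, inner_sub_right, real_inner_smul_left, real_inner_smul_right,
      h2, h3, h5, h6, h8, h9, hA]
  · ring
  · linear_combination (-⟪y, dirDeriv b X z⟫) * hsq +
      radius X N a b z ^ 2 * connectionCoeff X a b a z * hV
  · linear_combination (-⟪y, N z⟫) * hsq +
      radius X N a b z ^ 2 * normalCurvature X N a z * hV

/-- The integral curves of `a` are parallels with respect to a common axis, which is unique. -/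
theorem exists_axis (hf : IsRotational U X N a b) (hU : IsPreconnected U) (hne : U.Nonempty) :
    ∃ o w : E3, ‖w‖ = 1 ∧ ∀ z ∈ U, ⟪w, dirDeriv a X z⟫ = 0 ∧ ⟪X z - o, dirDeriv a X z⟫ = 0 ∧
      (∀ t : ℝ, X z - o ≠ t • w) ∧
      ∀ o' w' : E3, ‖w'‖ = 1 →
        (∀ᶠ y in nhds z, ⟪w', dirDeriv a X y⟫ = 0 ∧ ⟪X y - o', dirDeriv a X y⟫ = 0) →
        (w' = w ∨ w' = -w) ∧ ∃ t : ℝ, o' = o + t • w := by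
  obtain ⟨o, w, hw1, h⟩ := hf.exists_axis_centre_eq hU hne
  refine ⟨o, w, hw1, fun z hz => ?_⟩
  obtain ⟨hw, t, ht⟩ := h z hz
  obtain ⟨⟨h1, h2, h3⟩, ⟨h4, h5, h6⟩, h7, h8, h9⟩ := hf.inner_frame hz
  have hsq := hf.radius_sq hz
  have hwA : ⟪w, dirDeriv a X z⟫ = 0 := by
    simp [← hw, axis, inner_sub_left, real_inner_smul_left, h5, h6]
  have hwV : ⟪w, dirDeriv a (dirDeriv a X) z⟫ = 0 := by
    simp only [hf.dirDeriv_a_A hz, ← hw, axis, inner_sub_left, inner_add_right,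
      real_inner_smul_left, real_inner_smul_right, h2, h3, h8, h9]
    ring
  have hVV : ⟪dirDeriv a (dirDeriv a X) z, dirDeriv a (dirDeriv a X) z⟫ =
      connectionCoeff X a b a z ^ 2 + normalCurvature X N a z ^ 2 := by
    simp only [hf.dirDeriv_a_A hz, inner_add_left, inner_add_right,
      real_inner_smul_left, real_inner_smul_right, h2, h3, h8, h9]
    ring
  have hVA : ⟪dirDeriv a (dirDeriv a X) z, dirDeriv a X z⟫ = 0 := by
    simp [hf.dirDeriv_a_A hz, inner_add_left, real_inner_smul_left, h5, h6]
  have hX : X z - o =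
      t • w - (radius X N a b z * radius X N a b z) • dirDeriv a (dirDeriv a X) z := by
    rw [centre] at ht
    rw [sub_eq_iff_eq_add, sub_add_eq_add_sub, eq_sub_iff_add_eq, ht, add_comm]
  refine ⟨hwA, ?_, fun t' ht' => ?_, fun o' w' hw' hev => ?_⟩
  · rw [hX, inner_sub_left, real_inner_smul_left, real_inner_smul_left, hwA, hVA]
    ring
  -- Pairing `X - o = t w - r² V` with `V` gives `-1`, but a multiple of `w` would give `0`.
  · have := congrArg (fun v => ⟪v, dirDeriv a (dirDeriv a X) z⟫) (hX.symm.trans ht')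
    simp only [inner_sub_left, real_inner_smul_left, hwV, hVV] at this
    linarith
  · have hX' := hf.smooth_X.differentiableAt_of_isOpen hf.isOpen hz
    have hA' := hf.smooth_A.differentiableAt_of_isOpen hf.isOpen hz
    -- Uniqueness: differentiating the two conditions along `a` yields `⟪w', V⟫ = 0` and `⟪X - o',
    -- V⟫ = -1`. So `w'` and `centre - o'` are orthogonal to both `A` and `V`.
    have e1 := dirDeriv_inner a (differentiableAt_const w') hA'
    have e2 := dirDeriv_inner a (hX'.sub_const o') hA'
    have hev1 : (fun y => ⟪w', dirDeriv a X y⟫) =ᶠ[nhds z] fun _ => 0 := hev.mono fun y hy => hy.1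
    have hev2 : (fun y => ⟪X y - o', dirDeriv a X y⟫) =ᶠ[nhds z] fun _ => 0 :=
      hev.mono fun y hy => hy.2
    rw [dirDeriv_congr a hev1, dirDeriv_const, dirDeriv_const, inner_zero_left, add_zero] at e1
    rw [dirDeriv_congr a hev2, dirDeriv_const, dirDeriv_sub a hX' (differentiableAt_const o'),
      dirDeriv_const, sub_zero, h1] at e2
    have E1 := hf.eq_inner_axis_smul hz hev1.eq_of_nhds e1.symm
    have E2 := hf.eq_inner_axis_smul hz (y := centre X N a b z - o') (by
      rw [centre, add_sub_right_comm, inner_add_left, real_inner_smul_left, hVA, mul_zero, add_zero]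
      exact hev2.eq_of_nhds) (by
      rw [centre, add_sub_right_comm, inner_add_left, real_inner_smul_left, hVV]
      linear_combination hsq - e2)
    rw [hw] at E1 E2
    refine ⟨?_, t - ⟪centre X N a b z - o', w⟫, ?_⟩
    · have hn : |⟪w', w⟫| = 1 := by
        have := congrArg norm E1
        rw [norm_smul, hw', hw1, mul_one, Real.norm_eq_abs] at this
        exact this.symm
      rcases eq_or_eq_neg_of_abs_eq hn with h' | h'
      · left; rw [E1, h', one_smul]
      · right; rw [E1, h', neg_one_smul]
    · rw [sub_smul, ← E2, ht]
      abel

end IsRotational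
end IsPrincipalFrame

/-! ### Circular curvature lines. -/

theorem DifferentiableAt.hasDerivAt_line {E F : Type*} [NormedAddCommGroup E] [NormedSpace ℝ E]
    [NormedAddCommGroup F] [NormedSpace ℝ F] {f : E → F} {z e : E} {t : ℝ}
    (hf : DifferentiableAt ℝ f (z + t • e)) :
    HasDerivAt (fun t : ℝ => f (z + t • e)) (fderiv ℝ f (z + t • e) e) t := by
  have h : HasDerivAt (fun t : ℝ => z + t • e) e t := by
    simpa using ((hasDerivAt_id t).smul_const e).const_add z
  exact hf.hasFDerivAt.comp_hasDerivAt t h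

theorem tendsto_line {E : Type*} [NormedAddCommGroup E] [NormedSpace ℝ E] (z e : E) :
    Filter.Tendsto (fun t : ℝ => z + t • e) (nhds 0) (nhds z) := by
  have : Filter.Tendsto (fun t : ℝ => z + t • e) (nhds 0) (nhds (z + (0 : ℝ) • e)) :=
    Continuous.tendsto (by fun_prop) 0
  rwa [zero_smul, add_zero] at this

/-- A function which is constant along a line has vanishing derivative along it. -/
theorem DifferentiableAt.fderiv_eq_zero_of_line {E F : Type*} [NormedAddCommGroup E]
    [NormedSpace ℝ E] [NormedAddCommGroup F] [NormedSpace ℝ F] {f : E → F} {z e : E} {c : F}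
    (hf : DifferentiableAt ℝ f z) (h : ∀ᶠ t : ℝ in nhds 0, f (z + t • e) = c) :
    fderiv ℝ f z e = 0 := by
  have h1 := DifferentiableAt.hasDerivAt_line (f := f) (z := z) (e := e) (t := 0) (by simpa)
  simpa using h1.unique ((hasDerivAt_const 0 c).congr_of_eventuallyEq h)

namespace IsPrincipalFrame

variable {E : Type*} [NormedAddCommGroup E] [NormedSpace ℝ E] {U : Set E} {X N : E → E3}
  {a b : E → E} {z : E}

/-- Along a circle that is a curvature line the normal curvature is constant, and the curvature
of the curve does not vanish. -/
theorem of_circle (hf : IsPrincipalFrame U X N a b) {e : E} {s : E → ℝ}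
    (ha : ∀ z ∈ U, a z = s z • e) (hz : z ∈ U) {m τ : E3} {r : ℝ} (hτ : ‖τ‖ = 1)
    (hr : 0 < r) (hX : ∀ᶠ t : ℝ in nhds 0, X (z + t • e) ∈ circleInSpace m τ r) :
    dirDeriv a (normalCurvature X N a) z = 0 ∧ dirDeriv a (dirDeriv a X) z ≠ 0 := by
  have hU : ∀ᶠ t : ℝ in nhds 0, z + t • e ∈ U :=
    (tendsto_line z e).eventually (hf.isOpen.mem_nhds hz)
  obtain ⟨ε, hε, hball⟩ := Metric.eventually_nhds_iff_ball.1 (hX.and hU)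
  set I := Metric.ball (0 : ℝ) ε
  have hI : IsOpen I := Metric.isOpen_ball
  have hIc : IsPreconnected I := (convex_ball (0 : ℝ) ε).isPreconnected
  have h0 : (0 : ℝ) ∈ I := Metric.mem_ball_self hε
  have hcirc : ∀ t ∈ I, X (z + t • e) ∈ circleInSpace m τ r := fun t ht => (hball t ht).1
  have hmem : ∀ t ∈ I, z + t • e ∈ U := fun t ht => (hball t ht).2
  have hc : ∀ t ∈ I, HasDerivAt (fun t : ℝ => X (z + t • e) - m) (fderiv ℝ X (z + t • e) e) t :=
    fun t ht =>
    (hf.smooth_X.differentiableAt_of_isOpen hf.isOpen (hmem t ht)).hasDerivAt_line.sub_const m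
  have hs : ∀ t ∈ I, s (z + t • e) ≠ 0 := by
    intro t ht h
    have := hf.inner_a_a _ (hmem t ht)
    rw [dirDeriv, ha _ (hmem t ht), h, zero_smul, map_zero, inner_zero_left] at this
    exact zero_ne_one this
  have hN : ∀ t ∈ I, HasDerivAt (fun t : ℝ => N (z + t • e))
      (-normalCurvature X N a (z + t • e) • fderiv ℝ X (z + t • e) e) t := by
    intro t ht
    have h := (hf.smooth_N.differentiableAt_of_isOpen hf.isOpen (hmem t ht)).hasDerivAt_line
    have h' := hf.dirDeriv_a_N (hmem t ht)
    rw [dirDeriv, dirDeriv, ha _ (hmem t ht), map_smul, map_smul, smul_comm] at h'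
    rwa [smul_right_injective _ (hs t ht) h'] at h
  have hcc : ∀ t ∈ I, ⟪X (z + t • e) - m, fderiv ℝ X (z + t • e) e⟫ = 0 := by
    intro t ht
    have h := (hc t ht).inner ℝ (hc t ht)
    have h' : (fun t : ℝ => ⟪X (z + t • e) - m, X (z + t • e) - m⟫) =ᶠ[nhds t] fun _ => r ^ 2 :=
      Filter.eventually_of_mem (hI.mem_nhds ht) fun t ht => by
        beta_reduce
        rw [real_inner_self_eq_norm_sq, (hcirc t ht).1]
    have := h.unique ((hasDerivAt_const t (r ^ 2)).congr_of_eventuallyEq h')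
    linarith [real_inner_comm (X (z + t • e) - m) (fderiv ℝ X (z + t • e) e)]
  have hcτ : ∀ t ∈ I, ⟪fderiv ℝ X (z + t • e) e, τ⟫ = 0 := by
    intro t ht
    have h := (hc t ht).inner ℝ (hasDerivAt_const t τ)
    have h' : (fun t : ℝ => ⟪X (z + t • e) - m, τ⟫) =ᶠ[nhds t] fun _ => 0 :=
      Filter.eventually_of_mem (hI.mem_nhds ht) fun t ht => (hcirc t ht).2
    simpa using h.unique ((hasDerivAt_const t (0 : ℝ)).congr_of_eventuallyEq h')
  have hconst : ∀ f : ℝ → ℝ, (∀ t ∈ I, HasDerivAt f 0 t) → ∀ t ∈ I, f t = f 0 := fun f h t ht =>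
    hI.is_const_of_deriv_eq_zero hIc (fun t ht => (h t ht).differentiableAt.differentiableWithinAt)
      (fun t ht => (h t ht).deriv) ht h0
  -- Joachimsthal's argument: on a curvature line `N'` is parallel to `X'`, which is orthogonal to
  -- `X - m`, `τ` and `N`. So `N` has constant inner products with `X - m` and `τ`.
  have hφ := hconst (fun t => ⟪N (z + t • e), X (z + t • e) - m⟫) fun t ht => by
    have h := (hN t ht).inner ℝ (hc t ht)
    rwa [real_inner_smul_left, hf.inner_N _ (hmem t ht), real_inner_comm, hcc t ht, mul_zero,
      add_zero] at h
  have hψ := hconst (fun t => ⟪N (z + t • e), τ⟫) fun t ht => by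
    have h := (hN t ht).inner ℝ (hasDerivAt_const t τ)
    rwa [real_inner_smul_left, hcτ t ht, mul_zero, inner_zero_right, zero_add] at h
  have hA : ∀ t ∈ I, dirDeriv a X (z + t • e) = s (z + t • e) • fderiv ℝ X (z + t • e) e :=
    fun t ht => by rw [dirDeriv, ha _ (hmem t ht), map_smul]
  simp only [zero_smul, add_zero] at hφ hψ
  have hNeq : ∀ t ∈ I, N (z + t • e) =
      (⟪N z, X z - m⟫ / r ^ 2) • (X (z + t • e) - m) + ⟪N z, τ⟫ • τ := by
    intro t ht
    have hmm : ⟪X (z + t • e) - m, X (z + t • e) - m⟫ = r ^ 2 := by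
      rw [real_inner_self_eq_norm_sq, (hcirc t ht).1]
    have hττ : ⟪τ, τ⟫ = 1 := by rw [real_inner_self_eq_norm_sq, hτ, one_pow]
    have hmτ : ⟪X (z + t • e) - m, τ⟫ = 0 := (hcirc t ht).2
    have hτm : ⟪τ, X (z + t • e) - m⟫ = 0 := (real_inner_comm _ _).trans hmτ
    have hAm : ⟪dirDeriv a X (z + t • e), X (z + t • e) - m⟫ = 0 := by
      rw [hA t ht, real_inner_smul_left, real_inner_comm, hcc t ht, mul_zero]
    have hτA : ⟪τ, dirDeriv a X (z + t • e)⟫ = 0 := by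
      rw [hA t ht, real_inner_smul_right, real_inner_comm, hcτ t ht, mul_zero]
    have hmA := (real_inner_comm _ _).trans hAm
    refine E3.eq_of_inner_eq (A := dirDeriv a X (z + t • e)) (B := r⁻¹ • (X (z + t • e) - m))
      (N := τ) (hf.inner_a_a _ (hmem t ht)) ?_ hττ ?_ hτA ?_ ?_ ?_ ?_
    · rw [real_inner_smul_left, real_inner_smul_right, hmm]
      field_simp
    · rw [real_inner_smul_right, hAm, mul_zero]
    · rw [real_inner_smul_right, hτm, mul_zero]
    · rw [(hf.inner_frame (hmem t ht)).2.1.2.2, inner_add_left, real_inner_smul_left, real_inner_smul_left,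
        hmA, hτA]
      ring
    · rw [real_inner_smul_right, hφ t ht, inner_add_left, real_inner_smul_left,
        real_inner_smul_left, real_inner_smul_right, real_inner_smul_right, hmm, hτm]
      field_simp
      ring
    · rw [hψ t ht, inner_add_left, real_inner_smul_left, real_inner_smul_left, hmτ, hττ]
      ring
  -- Differentiating `N = c (X - m) + const` gives `N' = c X'`, whence `κ = -c`.
  have hκ : ∀ t ∈ I, normalCurvature X N a (z + t • e) = -(⟪N z, X z - m⟫ / r ^ 2) := by
    intro t ht
    have h1 := (((hc t ht).const_smul (⟪N z, X z - m⟫ / r ^ 2)).add_const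
      (⟪N z, τ⟫ • τ)).congr_of_eventuallyEq
      (Filter.eventually_of_mem (hI.mem_nhds ht) hNeq)
    have h2 := (hN t ht).unique h1
    have h3 : fderiv ℝ X (z + t • e) e ≠ 0 := by
      intro h
      have := hf.inner_a_a _ (hmem t ht)
      rw [hA t ht, h, smul_zero, inner_zero_left] at this
      exact zero_ne_one this
    linarith [smul_left_injective ℝ h3 h2]
  have hk := (hf.smooth_normalCurvature_a.differentiableAt_of_isOpen hf.isOpen
    hz).fderiv_eq_zero_of_line (Filter.eventually_of_mem (hI.mem_nhds h0) hκ)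
  refine ⟨by rw [dirDeriv, ha z hz, map_smul, hk, smul_zero], fun hV => ?_⟩
  have hX' := (hf.smooth_X.differentiableAt_of_isOpen hf.isOpen hz).sub_const m
  have hA' := hf.smooth_A.differentiableAt_of_isOpen hf.isOpen hz
  -- Differentiating `⟪A, X - m⟫ = 0` gives `⟪V, X - m⟫ = -1`, so `V` cannot vanish.
  have h1 := dirDeriv_inner a hA' hX'
  have h2 := (hA'.inner ℝ hX').fderiv_eq_zero_of_line (e := e) (c := (0 : ℝ))
    (Filter.eventually_of_mem (hI.mem_nhds h0) fun t ht => by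
      rw [hA t ht, real_inner_smul_left, real_inner_comm, hcc t ht, mul_zero])
  rw [dirDeriv, ha z hz, map_smul, h2, smul_zero, hV, inner_zero_left, add_zero,
    dirDeriv_sub a (hf.smooth_X.differentiableAt_of_isOpen hf.isOpen hz)
      (differentiableAt_const m), dirDeriv_const, sub_zero, hf.inner_a_a z hz] at h1
  exact zero_ne_one h1

end IsPrincipalFrame

/-! ### Frames in charts adapted to the foliation. -/

/-- An immersion whose second coordinate lines are curvature lines has a principal frame. -/
theorem exists_isPrincipalFrame {U : Set (EuclideanSpace ℝ (Fin 2))}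
    {X N : EuclideanSpace ℝ (Fin 2) → E3} (hU : IsOpen U) (hX : ContDiffOn ℝ ∞ X U)
    (hN : ContDiffOn ℝ ∞ N U) (hNN : ∀ z ∈ U, ‖N z‖ = 1)
    (hNX : ∀ z ∈ U, ∀ ξ, ⟪N z, fderiv ℝ X z ξ⟫ = 0)
    (hinj : ∀ z ∈ U, Function.Injective (fderiv ℝ X z))
    (hp : ∀ z ∈ U, ∃ k : ℝ, fderiv ℝ N z (EuclideanSpace.single 1 1) =
      k • fderiv ℝ X z (EuclideanSpace.single 1 1)) :
    ∃ (a b : EuclideanSpace ℝ (Fin 2) → EuclideanSpace ℝ (Fin 2))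
      (s : EuclideanSpace ℝ (Fin 2) → ℝ),
      IsPrincipalFrame U X N a b ∧ (∀ z ∈ U, a z = s z • EuclideanSpace.single 1 1) ∧
        ∀ z ∈ U, s z ≠ 0 := by
  set e₀ : EuclideanSpace ℝ (Fin 2) := EuclideanSpace.single 0 1
  set e₁ : EuclideanSpace ℝ (Fin 2) := EuclideanSpace.single 1 1
  have he₁ : e₁ ≠ 0 := by simp [e₁]
  have hdX : ∀ e, ContDiffOn ℝ ∞ (fun z => fderiv ℝ X z e) U := fun e =>
    (hX.fderiv_of_isOpen hU (by simp)).clm_apply contDiffOn_const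
  have hv : ∀ z ∈ U, fderiv ℝ X z e₁ ≠ 0 := fun z hz h => he₁ (hinj z hz (h.trans (map_zero _).symm))
  -- Gram–Schmidt in the parameter plane: `e₀ - q e₁` is orthogonal to `e₁` for the metric induced
  -- by `X`.
  set q : EuclideanSpace ℝ (Fin 2) → ℝ := fun z =>
    ⟪fderiv ℝ X z e₀, fderiv ℝ X z e₁⟫ / ⟪fderiv ℝ X z e₁, fderiv ℝ X z e₁⟫ with hq
  have hqs : ContDiffOn ℝ ∞ q U := ((hdX e₀).inner ℝ (hdX e₁)).div ((hdX e₁).inner ℝ (hdX e₁))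
    fun z hz => inner_self_ne_zero.2 (hv z hz)
  set W : EuclideanSpace ℝ (Fin 2) → EuclideanSpace ℝ (Fin 2) := fun z => e₀ - q z • e₁ with hW
  have hWs : ContDiffOn ℝ ∞ W U := contDiffOn_const.sub (hqs.smul contDiffOn_const)
  have hdW : ContDiffOn ℝ ∞ (fun z => fderiv ℝ X z (W z)) U :=
    (hX.fderiv_of_isOpen hU (by simp)).clm_apply hWs
  have hw : ∀ z ∈ U, fderiv ℝ X z (W z) ≠ 0 := fun z hz h => by
    have h1 := congrArg (fun y => y 0) (hinj z hz (h.trans (map_zero _).symm))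
    simp [hW, e₀, e₁] at h1
  have horth : ∀ z ∈ U, ⟪fderiv ℝ X z e₁, fderiv ℝ X z (W z)⟫ = 0 := fun z hz => by
    have h1 : ⟪fderiv ℝ X z e₁, fderiv ℝ X z e₁⟫ ≠ 0 := inner_self_ne_zero.2 (hv z hz)
    simp only [hW, hq, map_sub, map_smul, inner_sub_right, real_inner_smul_right]
    rw [div_mul_cancel₀ _ h1, real_inner_comm, sub_self]
  have hunit : ∀ y : E3, y ≠ 0 → ⟪‖y‖⁻¹ • y, ‖y‖⁻¹ • y⟫ = 1 := fun y hy => by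
    rw [real_inner_smul_left, real_inner_smul_right, real_inner_self_eq_norm_sq]
    have := norm_ne_zero_iff.2 hy
    field_simp
  refine ⟨fun z => ‖fderiv ℝ X z e₁‖⁻¹ • e₁, fun z => ‖fderiv ℝ X z (W z)‖⁻¹ • W z,
    fun z => ‖fderiv ℝ X z e₁‖⁻¹, ⟨hU, hX, hN, ?_, ?_, ?_, hNX, ?_, ?_, ?_, ?_, ?_⟩,
    fun z hz => rfl, fun z hz => inv_ne_zero (norm_ne_zero_iff.2 (hv z hz))⟩
  · exact (((hdX e₁).norm ℝ hv).inv fun z hz => norm_ne_zero_iff.2 (hv z hz)).smul contDiffOn_const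
  · exact ((hdW.norm ℝ hw).inv fun z hz => norm_ne_zero_iff.2 (hw z hz)).smul hWs
  · intro z hz
    rw [real_inner_self_eq_norm_sq, hNN z hz, one_pow]
  · intro z hz
    rw [dirDeriv, map_smul]
    exact hunit _ (hv z hz)
  · intro z hz
    rw [dirDeriv, map_smul]
    exact hunit _ (hw z hz)
  · intro z hz
    rw [dirDeriv, dirDeriv, map_smul, map_smul, real_inner_smul_left, real_inner_smul_right,
      horth z hz, mul_zero, mul_zero]
  · intro z hz ξ
    refine ⟨‖fderiv ℝ X z e₁‖ * (ξ 1 + ξ 0 * q z), ‖fderiv ℝ X z (W z)‖ * ξ 0, ?_⟩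
    rw [smul_smul, smul_smul, mul_right_comm, mul_right_comm _ (ξ 0),
      mul_inv_cancel₀ (norm_ne_zero_iff.2 (hv z hz)),
      mul_inv_cancel₀ (norm_ne_zero_iff.2 (hw z hz))]
    ext i
    fin_cases i <;> simp [hW, e₀, e₁]
  · intro z hz
    obtain ⟨k, hk⟩ := hp z hz
    exact ⟨k, by rw [dirDeriv, dirDeriv, map_smul, map_smul, hk, smul_comm]⟩

section Charts

variable {M : Type*} [TopologicalSpace M] [ChartedSpace (EuclideanSpace ℝ (Fin 2)) M]

theorem contDiffOn_comp_symm [IsManifold (𝓡 2) ∞ M]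
    {e : OpenPartialHomeomorph M (EuclideanSpace ℝ (Fin 2))}
    (he : e ∈ IsManifold.maximalAtlas (𝓡 2) ∞ M) {f : M → E3}
    (hf : ContMDiff (𝓡 2) 𝓘(ℝ, E3) ∞ f) : ContDiffOn ℝ ∞ (f ∘ e.symm) e.target :=
  (hf.comp_contMDiffOn (contMDiffOn_symm_of_mem_maximalAtlas he)).contDiffOn

theorem mdifferentiable_of_mem_maximalAtlas
    {e : OpenPartialHomeomorph M (EuclideanSpace ℝ (Fin 2))}
    (he : e ∈ IsManifold.maximalAtlas (𝓡 2) ∞ M) : e.MDifferentiable (𝓡 2) (𝓡 2) :=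
  ⟨(contMDiffOn_of_mem_maximalAtlas he).mdifferentiableOn (by simp),
    (contMDiffOn_symm_of_mem_maximalAtlas he).mdifferentiableOn (by simp)⟩

/-- The tangent space of a surface in a chart. -/
theorem exists_chart_tangent_equiv [IsManifold (𝓡 2) ∞ M]
    {e : OpenPartialHomeomorph M (EuclideanSpace ℝ (Fin 2))}
    (he : e ∈ IsManifold.maximalAtlas (𝓡 2) ∞ M) {z : EuclideanSpace ℝ (Fin 2)}
    (hz : z ∈ e.target) :
    ∃ L : EuclideanSpace ℝ (Fin 2) ≃ₗ[ℝ] TangentSpace (𝓡 2) (e.symm z),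
      (∀ ξ, L ξ = mfderiv (𝓡 2) (𝓡 2) e.symm z ξ) ∧
      (∀ f : M → E3, ContMDiff (𝓡 2) 𝓘(ℝ, E3) ∞ f → ∀ ξ,
        fderiv ℝ (f ∘ e.symm) z ξ = differential f (e.symm z) (L ξ)) ∧
      ∀ ξ, mfderiv (𝓡 2) 𝓘(ℝ, ℝ) (fun q' => e q' 0) (e.symm z) (L ξ) = (ξ 0 : ℝ) := by
  have hm := mdifferentiable_of_mem_maximalAtlas he
  have hb : Function.Bijective (mfderiv (𝓡 2) (𝓡 2) e.symm z) := hm.symm.mfderiv_bijective hz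
  refine ⟨LinearEquiv.ofBijective (mfderiv (𝓡 2) (𝓡 2) e.symm z).toLinearMap hb, fun ξ => rfl,
    fun f hf ξ => ?_, fun ξ => ?_⟩
  · have h := mfderiv_comp z ((hf (e.symm z)).mdifferentiableAt (by simp))
      (hm.mdifferentiableAt_symm hz)
    rw [mfderiv_eq_fderiv] at h
    rw [h]
    rfl
  · have h1 : MDifferentiableAt (𝓡 2) 𝓘(ℝ, ℝ) (EuclideanSpace.proj (𝕜 := ℝ) (0 : Fin 2))
        (e (e.symm z)) := ContinuousLinearMap.differentiableAt
          (EuclideanSpace.proj (𝕜 := ℝ) (0 : Fin 2)) |>.mdifferentiableAt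
    have h := mfderiv_comp (e.symm z) h1 (hm.mdifferentiableAt (e.map_target hz))
    have h2 := DFunLike.congr_fun (hm.comp_symm_deriv hz) ξ
    change mfderiv (𝓡 2) 𝓘(ℝ, ℝ) (EuclideanSpace.proj (𝕜 := ℝ) (0 : Fin 2) ∘ e) (e.symm z) _ = _
    rw [h, mfderiv_eq_fderiv, ContinuousLinearMap.fderiv]
    change EuclideanSpace.proj (𝕜 := ℝ) (0 : Fin 2) ((mfderiv (𝓡 2) (𝓡 2) e (e.symm z))
      (mfderiv (𝓡 2) (𝓡 2) e.symm z ξ)) = _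
    erw [h2]
    rfl

end Charts

theorem LinearMap.det_trace_of_eigenvectors {V : Type*} [AddCommGroup V] [Module ℝ V]
    (hV : Module.finrank ℝ V = 2) (f : Module.End ℝ V) {u v : V} {k l : ℝ}
    (huv : LinearIndependent ℝ ![u, v]) (hu : f u = k • u) (hv : f v = l • v) :
    LinearMap.det f = k * l ∧ LinearMap.trace ℝ V f = k + l := by
  let B := basisOfLinearIndependentOfCardEqFinrank huv (by simp [hV])
  have hB : LinearMap.toMatrix B B f = !![k, 0; 0, l] := by
    ext i j
    rw [LinearMap.toMatrix_apply]
    have hj : f (B j) = ![k, l] j • B j := by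
      fin_cases j <;> simp [B, hu, hv]
    rw [hj, map_smul]
    fin_cases i <;> fin_cases j <;> simp
  rw [← LinearMap.det_toMatrix B, LinearMap.trace_eq_matrix_trace ℝ B, hB]
  simp [Matrix.trace]

/-- A principal frame in a chart adapted to a family of circular curvature lines. -/
structure IsAdaptedFrame {M : Type*} [TopologicalSpace M]
    [ChartedSpace (EuclideanSpace ℝ (Fin 2)) M] (s : SurfaceInSpace M)
    (D : ∀ p : M, Submodule ℝ (TangentSpace (𝓡 2) p))
    (e : OpenPartialHomeomorph M (EuclideanSpace ℝ (Fin 2)))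
    (a b : EuclideanSpace ℝ (Fin 2) → EuclideanSpace ℝ (Fin 2)) : Prop where
  mem_maximalAtlas : e ∈ IsManifold.maximalAtlas (𝓡 2) ∞ M
  frame : IsPrincipalFrame e.target (s.x ∘ e.symm) (s.n ∘ e.symm) a b
  exists_smul : ∀ z ∈ e.target, ∃ c : ℝ, c ≠ 0 ∧ a z = c • EuclideanSpace.single 1 1
  dirDeriv_normalCurvature : ∀ z ∈ e.target,
    dirDeriv a (normalCurvature (s.x ∘ e.symm) (s.n ∘ e.symm) a) z = 0
  curvature_ne_zero : ∀ z ∈ e.target, dirDeriv a (dirDeriv a (s.x ∘ e.symm)) z ≠ 0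
  isPrincipalCurvature_a : ∀ z ∈ e.target, s.IsPrincipalCurvature (e.symm z)
    (normalCurvature (s.x ∘ e.symm) (s.n ∘ e.symm) a z)
  isPrincipalCurvature_b : ∀ z ∈ e.target, s.IsPrincipalCurvature (e.symm z)
    (normalCurvature (s.x ∘ e.symm) (s.n ∘ e.symm) b z)
  gaussCurvature_eq : ∀ z ∈ e.target, s.gaussCurvature (e.symm z) =
    normalCurvature (s.x ∘ e.symm) (s.n ∘ e.symm) a z *
      normalCurvature (s.x ∘ e.symm) (s.n ∘ e.symm) b z
  meanCurvature_eq : ∀ z ∈ e.target, 2 * s.meanCurvature (e.symm z) =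
    normalCurvature (s.x ∘ e.symm) (s.n ∘ e.symm) a z +
      normalCurvature (s.x ∘ e.symm) (s.n ∘ e.symm) b z
  shapeOperator_iff : ∀ z ∈ e.target, ∀ k : ℝ,
    (∀ Y ∈ D (e.symm z), s.shapeOperator (e.symm z) Y = k • Y) ↔
      k = normalCurvature (s.x ∘ e.symm) (s.n ∘ e.symm) a z
  inner_iff : ∀ z ∈ e.target, ∀ w : E3,
    (∀ Y ∈ D (e.symm z), ⟪w, differential s.x (e.symm z) Y⟫ = 0) ↔
      ⟪w, dirDeriv a (s.x ∘ e.symm) z⟫ = 0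

section Adapted

variable {M : Type*} [TopologicalSpace M] [ChartedSpace (EuclideanSpace ℝ (Fin 2)) M]
  [IsManifold (𝓡 2) ∞ M] {s : SurfaceInSpace M}
  {D : ∀ p : M, Submodule ℝ (TangentSpace (𝓡 2) p)}

/-- In a foliation chart `D = ker du`, so the `v`-lines are tangent to `D`. This lets the hypothesis
on leaf arcs be applied to coordinate segments. -/
theorem isLeafArc_coordinate_line {e : OpenPartialHomeomorph M (EuclideanSpace ℝ (Fin 2))}
    (he : e ∈ IsManifold.maximalAtlas (𝓡 2) ∞ M)
    (hfol : ∀ q ∈ e.source, ∀ X : TangentSpace (𝓡 2) q,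
      X ∈ D q ↔ mfderiv (𝓡 2) 𝓘(ℝ, ℝ) (fun q' => e q' 0) q X = (0 : ℝ))
    {z : EuclideanSpace ℝ (Fin 2)} {t₀ t₁ : ℝ}
    (h : ∀ t ∈ Ioo t₀ t₁, z + t • EuclideanSpace.single 1 1 ∈ e.target) :
    IsLeafArc D (fun t => e.symm (z + t • EuclideanSpace.single 1 1)) t₀ t₁ := by
  set ℓ : ℝ → EuclideanSpace ℝ (Fin 2) := fun t => z + t • EuclideanSpace.single 1 1 with hℓ
  have hs : ContDiff ℝ ∞ ℓ := contDiff_const.add (contDiff_id.smul contDiff_const)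
  refine ⟨(contMDiffOn_symm_of_mem_maximalAtlas he).comp hs.contMDiff.contMDiffOn h,
    fun t ht => ?_⟩
  obtain ⟨L, hL, -, hL0⟩ := exists_chart_tangent_equiv he (h t ht)
  have hm := mdifferentiable_of_mem_maximalAtlas he
  have hd : HasDerivAt ℓ (EuclideanSpace.single 1 1) t := by
    have := ((hasDerivAt_id t).smul_const (EuclideanSpace.single (1 : Fin 2) (1 : ℝ))).const_add z
    rwa [one_smul] at this
  have hv : mfderiv 𝓘(ℝ, ℝ) (𝓡 2) (fun t => e.symm (ℓ t)) t (1 : ℝ) =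
      L (EuclideanSpace.single 1 1) := by
    have h1 := mfderiv_comp (I := 𝓘(ℝ, ℝ)) (I' := 𝓡 2) (I'' := 𝓡 2) t
      (hm.mdifferentiableAt_symm (h t ht)) hd.differentiableAt.mdifferentiableAt
    have h2 : mfderiv 𝓘(ℝ, ℝ) (𝓡 2) ℓ t (1 : ℝ) = EuclideanSpace.single 1 1 := by
      have : mfderiv 𝓘(ℝ, ℝ) (𝓡 2) ℓ t = fderiv ℝ ℓ t := mfderiv_eq_fderiv
      rw [this, hd.hasFDerivAt.fderiv]
      exact one_smul ℝ _
    rw [hL]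
    change mfderiv 𝓘(ℝ, ℝ) (𝓡 2) (e.symm ∘ ℓ) t (1 : ℝ) = _
    rw [h1]
    change mfderiv (𝓡 2) (𝓡 2) e.symm (ℓ t) (mfderiv 𝓘(ℝ, ℝ) (𝓡 2) ℓ t (1 : ℝ)) = _
    rw [h2]
  rw [hv]
  refine ⟨(map_ne_zero_iff L L.injective).2 (by simp), ?_⟩
  rw [hfol _ (e.map_target (h t ht)), hL0]
  have h0 : EuclideanSpace.single (1 : Fin 2) (1 : ℝ) 0 = 0 := by simp
  exact h0

theorem IsCircularCurvatureLineFamily.exists_isAdaptedFrame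
    (hD : IsCircularCurvatureLineFamily s D) (p : M) :
    ∃ (e : OpenPartialHomeomorph M (EuclideanSpace ℝ (Fin 2)))
      (a b : EuclideanSpace ℝ (Fin 2) → EuclideanSpace ℝ (Fin 2)),
      p ∈ e.source ∧ (∀ q ∈ e.source, ∀ X : TangentSpace (𝓡 2) q,
        X ∈ D q ↔ mfderiv (𝓡 2) 𝓘(ℝ, ℝ) (fun q' => e q' 0) q X = (0 : ℝ)) ∧
      IsAdaptedFrame s D e a b := by
  obtain ⟨e, he, hp, hfol⟩ := hD.foliation p
  have hmemD : ∀ z ∈ e.target, ∀ L : EuclideanSpace ℝ (Fin 2) ≃ₗ[ℝ]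
      TangentSpace (𝓡 2) (e.symm z), (∀ ξ, mfderiv (𝓡 2) 𝓘(ℝ, ℝ) (fun q' => e q' 0)
        (e.symm z) (L ξ) = (ξ 0 : ℝ)) → ∀ ξ, L ξ ∈ D (e.symm z) ↔ ξ 0 = 0 := by
    intro z hz L hL ξ
    rw [hfol _ (e.map_target hz), hL]
    exact Iff.rfl
  obtain ⟨a, b, c, hf, hc, hc0⟩ := exists_isPrincipalFrame e.open_target
    (contDiffOn_comp_symm he s.smooth_x) (contDiffOn_comp_symm he s.smooth_n)
    (fun z _ => s.unit_normal _)
    (fun z hz ξ => by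
      obtain ⟨L, -, hL, -⟩ := exists_chart_tangent_equiv he hz
      rw [hL _ s.smooth_x]
      exact s.normal _ _)
    (fun z hz => by
      obtain ⟨L, -, hL, -⟩ := exists_chart_tangent_equiv he hz
      rw [funext (hL _ s.smooth_x)]
      exact (s.immersion _).comp L.injective)
    (fun z hz => by
      obtain ⟨L, -, hL, hL0⟩ := exists_chart_tangent_equiv he hz
      obtain ⟨k, hk⟩ := hD.curvatureLine (e.symm z) (L (EuclideanSpace.single 1 1))
        ((hmemD z hz L hL0 _).2 (by simp))
      refine ⟨-k, ?_⟩
      rw [hL _ s.smooth_x, hL _ s.smooth_n, neg_smul, ← map_smul, ← hk,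
        s.differential_shapeOperator, neg_neg])
  have hcirc : ∀ z ∈ e.target,
      dirDeriv a (normalCurvature (s.x ∘ e.symm) (s.n ∘ e.symm) a) z = 0 ∧
        dirDeriv a (dirDeriv a (s.x ∘ e.symm)) z ≠ 0 := by
    intro z hz
    -- A short coordinate segment through `z` stays in the chart; it is a leaf arc, hence lies on a
    -- circle.
    obtain ⟨ε, hε, hball⟩ := Metric.eventually_nhds_iff_ball.1
      ((tendsto_line z (EuclideanSpace.single 1 1)).eventually (e.open_target.mem_nhds hz))
    rw [Real.ball_eq_Ioo, zero_sub, zero_add] at hball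
    obtain ⟨m, τ, r, hτ, hr, h⟩ := hD.circular _ _ _ (isLeafArc_coordinate_line he hfol hball)
    exact hf.of_circle hc hz hτ hr
      (Filter.eventually_of_mem (Ioo_mem_nhds (by linarith) hε) h)
  have hshape : ∀ z ∈ e.target, ∀ L : EuclideanSpace ℝ (Fin 2) ≃ₗ[ℝ]
      TangentSpace (𝓡 2) (e.symm z), (∀ f : M → E3, ContMDiff (𝓡 2) 𝓘(ℝ, E3) ∞ f → ∀ ξ,
        fderiv ℝ (f ∘ e.symm) z ξ = differential f (e.symm z) (L ξ)) →
      s.shapeOperator (e.symm z) (L (a z)) =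
        normalCurvature (s.x ∘ e.symm) (s.n ∘ e.symm) a z • L (a z) ∧
      s.shapeOperator (e.symm z) (L (b z)) =
        normalCurvature (s.x ∘ e.symm) (s.n ∘ e.symm) b z • L (b z) := by
    intro z hz L hL
    constructor <;> apply s.immersion <;>
      rw [s.differential_shapeOperator, map_smul, ← hL _ s.smooth_x, ← hL _ s.smooth_n]
    · exact neg_eq_iff_eq_neg.2 ((hf.dirDeriv_a_N hz).trans (neg_smul _ _))
    · exact neg_eq_iff_eq_neg.2 ((hf.dirDeriv_b_N hz).trans (neg_smul _ _))
  have hli : ∀ z ∈ e.target, LinearIndependent ℝ ![a z, b z] := by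
    intro z hz
    obtain ⟨⟨h1, h2, h3⟩, ⟨h4, h5, h6⟩, h7, h8, h9⟩ := hf.inner_frame hz
    rw [LinearIndependent.pair_iff]
    intro x y hxy
    have h := congrArg (fderiv ℝ (s.x ∘ e.symm) z) hxy
    rw [map_add, map_smul, map_smul, map_zero] at h
    change x • dirDeriv a (s.x ∘ e.symm) z + y • dirDeriv b (s.x ∘ e.symm) z = 0 at h
    have hA := congrArg (fun w => ⟪w, dirDeriv a (s.x ∘ e.symm) z⟫) h
    have hB := congrArg (fun w => ⟪w, dirDeriv b (s.x ∘ e.symm) z⟫) h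
    simp only [inner_add_left, real_inner_smul_left, h1, h2, h4, h5, inner_zero_left] at hA hB
    constructor <;> linarith
  have hli' : ∀ z ∈ e.target, ∀ L : EuclideanSpace ℝ (Fin 2) ≃ₗ[ℝ]
      TangentSpace (𝓡 2) (e.symm z), LinearIndependent ℝ ![L (a z), L (b z)] := by
    intro z hz L
    have := (hli z hz).map' L.toLinearMap L.ker
    have h : L ∘ ![a z, b z] = ![L (a z), L (b z)] := by
      funext i
      fin_cases i <;> rfl
    exact h ▸ this
  have hspan : ∀ z ∈ e.target, ∀ L : EuclideanSpace ℝ (Fin 2) ≃ₗ[ℝ]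
      TangentSpace (𝓡 2) (e.symm z), (∀ ξ, mfderiv (𝓡 2) 𝓘(ℝ, ℝ) (fun q' => e q' 0)
        (e.symm z) (L ξ) = (ξ 0 : ℝ)) → L (a z) ∈ D (e.symm z) ∧
        ∀ Y ∈ D (e.symm z), ∃ t : ℝ, Y = t • L (a z) := by
    intro z hz L hL0
    refine ⟨(hmemD z hz L hL0 _).2 (by simp [hc z hz]), fun Y hY => ?_⟩
    have h0 : L.symm Y 0 = 0 := by rw [← hmemD z hz L hL0, L.apply_symm_apply]; exact hY
    refine ⟨(c z)⁻¹ * L.symm Y 1, ?_⟩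
    rw [← map_smul, hc z hz, ← L.symm_apply_eq, smul_smul, mul_right_comm,
      inv_mul_cancel₀ (hc0 z hz), one_mul]
    ext i
    fin_cases i <;> simp [h0]
  have hrank : ∀ q : M, Module.finrank ℝ (TangentSpace (𝓡 2) q) = 2 := fun q =>
    (finrank_euclideanSpace_fin : Module.finrank ℝ (EuclideanSpace ℝ (Fin 2)) = 2)
  refine ⟨e, a, b, hp, hfol, he, hf, fun z hz => ⟨c z, hc0 z hz, hc z hz⟩,
    fun z hz => (hcirc z hz).1, fun z hz => (hcirc z hz).2, fun z hz => ?_, fun z hz => ?_,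
    fun z hz => ?_, fun z hz => ?_, fun z hz k => ?_, fun z hz w => ?_⟩ <;>
    obtain ⟨L, -, hL, hL0⟩ := exists_chart_tangent_equiv he hz <;>
    obtain ⟨hSa, hSb⟩ := hshape z hz L hL <;>
    have hne := (hli' z hz L).ne_zero
  · exact Module.End.hasEigenvalue_of_hasEigenvector
      ⟨Module.End.mem_eigenspace_iff.2 hSa, hne 0⟩
  · exact Module.End.hasEigenvalue_of_hasEigenvector
      ⟨Module.End.mem_eigenspace_iff.2 hSb, hne 1⟩
  · exact (LinearMap.det_trace_of_eigenvectors (hrank _) _ (hli' z hz L) hSa hSb).1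
  · rw [SurfaceInSpace.meanCurvature,
      (LinearMap.det_trace_of_eigenvectors (hrank _) _ (hli' z hz L) hSa hSb).2]
    ring
  · obtain ⟨hmem, hsp⟩ := hspan z hz L hL0
    constructor
    · intro h
      exact smul_left_injective ℝ (hne 0) ((h _ hmem).symm.trans hSa)
    · rintro rfl Y hY
      obtain ⟨t, rfl⟩ := hsp Y hY
      rw [map_smul, hSa, smul_comm]
  · obtain ⟨hmem, hsp⟩ := hspan z hz L hL0
    rw [dirDeriv, hL _ s.smooth_x]
    constructor
    · exact fun h => h _ hmem
    · intro h Y hY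
      obtain ⟨t, rfl⟩ := hsp Y hY
      rw [map_smul, real_inner_smul_right, h, mul_zero]

end Adapted

/-! ### Absence of umbilics, and gluing of the local axes. -/

/-- Both `P` and its negation hold on open sets, so the set where `P` holds is clopen. -/
theorem forall_of_locally {M : Type*} [TopologicalSpace M] [PreconnectedSpace M] {P : M → Prop}
    (h : ∀ p, ∃ V ∈ nhds p, (∃ q ∈ V, P q) → ∀ q ∈ V, P q) {p₀ : M} (h₀ : P p₀) (p : M) : P p := by
  have hc : IsClopen {p | P p} := by
    constructor
    · rw [← isOpen_compl_iff, isOpen_iff_mem_nhds]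
      intro q hq
      obtain ⟨V, hV, hV'⟩ := h q
      exact Filter.mem_of_superset hV fun q' hq' hP => hq (hV' ⟨q', hq', hP⟩ q (mem_of_mem_nhds hV))
    · rw [isOpen_iff_mem_nhds]
      intro q hq
      obtain ⟨V, hV, hV'⟩ := h q
      exact Filter.mem_of_superset hV (hV' ⟨q, mem_of_mem_nhds hV, hq⟩)
  exact (hc.eq_univ ⟨p₀, h₀⟩).ge (mem_univ p)

/-- Unique continuation for solutions of a linear first order equation `df = f c`. -/
theorem Convex.eq_zero_of_fderiv_eq_mul {E : Type*} [NormedAddCommGroup E] [NormedSpace ℝ E]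
    {B : Set E} (hB : Convex ℝ B) {f : E → ℝ} {c : E → E → ℝ}
    (hf : ∀ z ∈ B, DifferentiableAt ℝ f z) (hc : ∀ ξ, ContinuousOn (fun z => c z ξ) B)
    (h : ∀ z ∈ B, ∀ ξ, fderiv ℝ f z ξ = c z ξ * f z) {z : E} (hz : z ∈ B) (h0 : f z = 0)
    {z' : E} (hz' : z' ∈ B) : f z' = 0 := by
  have hmem : ∀ t ∈ Icc (0 : ℝ) 1, z + t • (z' - z) ∈ B := fun t ht =>
    hB.add_smul_sub_mem hz hz' ht
  have hd : ∀ t ∈ Icc (0 : ℝ) 1, HasDerivAt (fun t : ℝ => f (z + t • (z' - z)))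
      (fderiv ℝ f (z + t • (z' - z)) (z' - z)) t := fun t ht =>
    (hf _ (hmem t ht)).hasDerivAt_line
  obtain ⟨C, hC⟩ := isCompact_Icc.exists_bound_of_continuousOn
    ((hc (z' - z)).comp (f := fun t : ℝ => z + t • (z' - z)) (by fun_prop) hmem)
  -- Grönwall on the segment from `z` to `z'`, where the coefficient is bounded by compactness.
  have := eq_zero_of_abs_deriv_le_mul_abs_self_of_eq_zero_right (K := C)
    (fun t ht => (hd t ht).continuousAt.continuousWithinAt)
    (fun t ht => (hd t (Ico_subset_Icc_self ht)).hasDerivWithinAt) (by simpa using h0)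
    (fun t ht => by
      have ht' := Ico_subset_Icc_self ht
      rw [h _ (hmem t ht'), norm_mul]
      exact mul_le_mul_of_nonneg_right (hC t ht') (norm_nonneg _)) 1 (right_mem_Icc.2 zero_le_one)
  simpa using this

theorem IsPrincipalFrame.mono {E : Type*} [NormedAddCommGroup E] [NormedSpace ℝ E] {U V : Set E}
    {X N : E → E3} {a b : E → E} (hf : IsPrincipalFrame U X N a b) (hVU : V ⊆ U)
    (hV : IsOpen V) : IsPrincipalFrame V X N a b where
  isOpen := hV
  smooth_X := hf.smooth_X.mono hVU
  smooth_N := hf.smooth_N.mono hVU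
  smooth_a := hf.smooth_a.mono hVU
  smooth_b := hf.smooth_b.mono hVU
  inner_N_N z hz := hf.inner_N_N z (hVU hz)
  inner_N z hz := hf.inner_N z (hVU hz)
  inner_a_a z hz := hf.inner_a_a z (hVU hz)
  inner_b_b z hz := hf.inner_b_b z (hVU hz)
  inner_a_b z hz := hf.inner_a_b z (hVU hz)
  span z hz := hf.span z (hVU hz)
  principal z hz := hf.principal z (hVU hz)

theorem IsPrincipalFrame.IsRotational.mono {E : Type*} [NormedAddCommGroup E] [NormedSpace ℝ E]
    {U V : Set E} {X N : E → E3} {a b : E → E} (hf : IsRotational U X N a b) (hVU : V ⊆ U)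
    (hV : IsOpen V) : IsRotational V X N a b where
  toIsPrincipalFrame := hf.toIsPrincipalFrame.mono hVU hV
  dirDeriv_normalCurvature_a z hz := hf.dirDeriv_normalCurvature_a z (hVU hz)
  dirDeriv_normalCurvature_b z hz := hf.dirDeriv_normalCurvature_b z (hVU hz)
  normalCurvature_ne z hz := hf.normalCurvature_ne z (hVU hz)
  curvature_ne_zero z hz := hf.curvature_ne_zero z (hVU hz)

section Global

variable {M : Type*} [TopologicalSpace M] [ChartedSpace (EuclideanSpace ℝ (Fin 2)) M]
  {s : SurfaceInSpace M}
  {D : ∀ p : M, Submodule ℝ (TangentSpace (𝓡 2) p)}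
  {e : OpenPartialHomeomorph M (EuclideanSpace ℝ (Fin 2))}
  {a b : EuclideanSpace ℝ (Fin 2) → EuclideanSpace ℝ (Fin 2)}
  {α β γ : ℝ}

theorem IsAdaptedFrame.linearWeingarten (hf : IsAdaptedFrame s D e a b)
    (hLW : ∀ p, α * s.gaussCurvature p + 2 * β * s.meanCurvature p + γ = 0)
    {z : EuclideanSpace ℝ (Fin 2)} (hz : z ∈ e.target) :
    α * (normalCurvature (s.x ∘ e.symm) (s.n ∘ e.symm) a z *
      normalCurvature (s.x ∘ e.symm) (s.n ∘ e.symm) b z) +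
      β * (normalCurvature (s.x ∘ e.symm) (s.n ∘ e.symm) a z +
      normalCurvature (s.x ∘ e.symm) (s.n ∘ e.symm) b z) + γ = 0 := by
  have h := hLW (e.symm z)
  rw [hf.gaussCurvature_eq z hz] at h
  linear_combination h - β * hf.meanCurvature_eq z hz

/-- Only the `b` component of `ξ` contributes, as `κ` is constant along `a`; the first Codazzi
equation supplies the rest. -/
theorem IsAdaptedFrame.fderiv_normalCurvature (hf : IsAdaptedFrame s D e a b)
    {z : EuclideanSpace ℝ (Fin 2)} (hz : z ∈ e.target) (ξ : EuclideanSpace ℝ (Fin 2)) :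
    fderiv ℝ (normalCurvature (s.x ∘ e.symm) (s.n ∘ e.symm) a) z ξ =
      ⟪fderiv ℝ (s.x ∘ e.symm) z ξ, dirDeriv b (s.x ∘ e.symm) z⟫ *
      (connectionCoeff (s.x ∘ e.symm) a b a z *
      (normalCurvature (s.x ∘ e.symm) (s.n ∘ e.symm) a z -
        normalCurvature (s.x ∘ e.symm) (s.n ∘ e.symm) b z)) := by
  obtain ⟨⟨h1, h2, h3⟩, ⟨h4, h5, h6⟩, h7, h8, h9⟩ := hf.frame.inner_frame hz
  obtain ⟨p, q, rfl⟩ := hf.frame.span z hz ξ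
  rw [← (hf.frame.codazzi hz).1]
  simp only [map_add, map_smul]
  change p • dirDeriv a _ z + q • dirDeriv b _ z = ⟪p • dirDeriv a _ z + q • dirDeriv b _ z, _⟫ * _
  rw [hf.dirDeriv_normalCurvature z hz, inner_add_left, real_inner_smul_left,
    real_inner_smul_left, h2, h4]
  simp

variable [IsManifold (𝓡 2) ∞ M]

/-- The linear Weingarten relation can be solved for the second principal curvature. -/
theorem IsAdaptedFrame.add_ne_zero (hf : IsAdaptedFrame s D e a b) (hnt : ¬ s.IsTubular)
    (hD : IsCircularCurvatureLineFamily s D) (h0 : α ≠ 0 ∨ β ≠ 0 ∨ γ ≠ 0)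
    (hLW : ∀ p, α * s.gaussCurvature p + 2 * β * s.meanCurvature p + γ = 0)
    {z : EuclideanSpace ℝ (Fin 2)} (hz : z ∈ e.target) :
    α * normalCurvature (s.x ∘ e.symm) (s.n ∘ e.symm) a z + β ≠ 0 := by
  intro h
  have hrel := hf.linearWeingarten hLW hz
  set κ := normalCurvature (s.x ∘ e.symm) (s.n ∘ e.symm) a z with hκ
  have hγ : β * κ + γ = 0 := by
    linear_combination hrel - normalCurvature (s.x ∘ e.symm) (s.n ∘ e.symm) b z * h
  have hα : α ≠ 0 := by
    rintro rfl
    have hβ : β = 0 := by linarith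
    subst hβ
    have : γ = 0 := by linarith
    simp_all
  refine hnt ⟨κ, fun p => ?_⟩
  obtain ⟨e', a', b', hp, -, hf'⟩ := hD.exists_isAdaptedFrame p
  have hz' := e'.map_source hp
  have hrel' := hf'.linearWeingarten hLW hz'
  have ha := hf'.isPrincipalCurvature_a _ hz'
  have hb := hf'.isPrincipalCurvature_b _ hz'
  rw [e'.left_inv hp] at ha hb
  -- From `α κ + β = 0` and `β κ + γ = 0` the Weingarten relation becomes `α (k₁ - κ) (k₂ - κ) = 0`
  -- at every point.
  have hprod : (normalCurvature (s.x ∘ e'.symm) (s.n ∘ e'.symm) a' (e' p) - κ) *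
      (normalCurvature (s.x ∘ e'.symm) (s.n ∘ e'.symm) b' (e' p) - κ) = 0 := by
    apply mul_left_cancel₀ hα
    linear_combination hrel' - hγ - (normalCurvature (s.x ∘ e'.symm) (s.n ∘ e'.symm) a' (e' p) +
      normalCurvature (s.x ∘ e'.symm) (s.n ∘ e'.symm) b' (e' p) - κ) * h
  rcases mul_eq_zero.1 hprod with h1 | h1
  · rwa [sub_eq_zero.1 h1] at ha
  · rwa [sub_eq_zero.1 h1] at hb

/-- Since `k` is a root of the umbilic equation, solving for `λ` gives `(α κ + β) (κ - λ) = (α (κ +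
k) + 2 β) (κ - k)`. Thus Codazzi is a homogeneous linear equation for `κ - k`, and a zero spreads
over the convex set. -/
theorem IsAdaptedFrame.normalCurvature_eq_of_umbilic (hf : IsAdaptedFrame s D e a b)
    (hnt : ¬ s.IsTubular) (hD : IsCircularCurvatureLineFamily s D) (h0 : α ≠ 0 ∨ β ≠ 0 ∨ γ ≠ 0)
    (hLW : ∀ p, α * s.gaussCurvature p + 2 * β * s.meanCurvature p + γ = 0) {k : ℝ}
    (hk : α * k ^ 2 + 2 * β * k + γ = 0) {B : Set (EuclideanSpace ℝ (Fin 2))} (hB : Convex ℝ B)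
    (hBe : B ⊆ e.target) {z z' : EuclideanSpace ℝ (Fin 2)} (hz : z ∈ B) (hz' : z' ∈ B)
    (h : normalCurvature (s.x ∘ e.symm) (s.n ∘ e.symm) a z = k) :
    normalCurvature (s.x ∘ e.symm) (s.n ∘ e.symm) a z' = k := by
  set κ := normalCurvature (s.x ∘ e.symm) (s.n ∘ e.symm) a with hκ
  have hne : ∀ z ∈ e.target, α * κ z + β ≠ 0 := fun z hz => hf.add_ne_zero hnt hD h0 hLW hz
  have hsm := hf.frame.smooth_normalCurvature_a
  rw [← hκ] at hsm
  rw [← sub_eq_zero] at h ⊢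
  refine hB.eq_zero_of_fderiv_eq_mul (f := fun z => κ z - k)
    (c := fun z ξ => ⟪fderiv ℝ (s.x ∘ e.symm) z ξ, dirDeriv b (s.x ∘ e.symm) z⟫ *
      (connectionCoeff (s.x ∘ e.symm) a b a z * ((α * (κ z + k) + 2 * β) / (α * κ z + β))))
    (fun z hz => (hsm.differentiableAt_of_isOpen e.open_target (hBe hz)).sub_const k)
    (fun ξ => ContinuousOn.mono ?_ hBe) (fun z hz ξ => ?_) hz h hz'
  · refine ContinuousOn.mul (ContDiffOn.inner ℝ ?_ hf.frame.smooth_B).continuousOn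
      (hf.frame.smooth_connectionCoeff_a.continuousOn.mul (ContinuousOn.div ?_ ?_ hne))
    · exact (hf.frame.smooth_X.fderiv_of_isOpen e.open_target (by simp)).clm_apply
        contDiffOn_const
    · exact (continuousOn_const.mul (hsm.continuousOn.add continuousOn_const)).add
        continuousOn_const
    · exact (continuousOn_const.mul hsm.continuousOn).add continuousOn_const
  · rw [fderiv_sub_const, hf.fderiv_normalCurvature (hBe hz)]
    have hrel := hf.linearWeingarten hLW (hBe hz)
    have h1 := hne z (hBe hz)
    rw [← hκ] at hrel ⊢
    have h2 : κ z - normalCurvature (s.x ∘ e.symm) (s.n ∘ e.symm) b z =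
        (α * (κ z + k) + 2 * β) / (α * κ z + β) * (κ z - k) := by
      rw [div_mul_eq_mul_div, eq_div_iff h1]
      linear_combination hk - hrel
    rw [h2]
    ring

/-- A non-tubular linear Weingarten surface with a family of circular curvature lines has no
umbilics, and both principal curvatures are constant along the circles. -/
theorem IsAdaptedFrame.isRotational [PreconnectedSpace M] (hf : IsAdaptedFrame s D e a b)
    (hnt : ¬ s.IsTubular) (hD : IsCircularCurvatureLineFamily s D)
    (hLW : s.IsLinearWeingarten) :
    IsPrincipalFrame.IsRotational e.target (s.x ∘ e.symm) (s.n ∘ e.symm) a b := by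
  obtain ⟨α, β, γ, h0, hLW⟩ := hLW
  refine ⟨hf.frame, hf.dirDeriv_normalCurvature, fun z hz => ?_, fun z hz heq => ?_,
    hf.curvature_ne_zero⟩
  · have ha := hf.frame.smooth_normalCurvature_a.differentiableAt_of_isOpen e.open_target hz
    have hb := hf.frame.smooth_normalCurvature_b.differentiableAt_of_isOpen e.open_target hz
    -- The Weingarten relation differentiated along `a` is `(α κ + β) D_a λ = 0`.
    have h := dirDeriv_eq_zero_of_isOpen e.open_target a
      (fun z hz => hf.linearWeingarten hLW hz) hz
    rw [dirDeriv_add a (((differentiableAt_const α).fun_mul (ha.fun_mul hb)).fun_add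
      ((differentiableAt_const β).fun_mul (ha.fun_add hb))) (differentiableAt_const γ),
      dirDeriv_add a ((differentiableAt_const α).fun_mul (ha.fun_mul hb))
      ((differentiableAt_const β).fun_mul (ha.fun_add hb)),
      dirDeriv_mul a (differentiableAt_const α) (ha.fun_mul hb),
      dirDeriv_mul a (differentiableAt_const β) (ha.fun_add hb), dirDeriv_mul a ha hb,
      dirDeriv_add a ha hb, hf.dirDeriv_normalCurvature z hz] at h
    simp only [dirDeriv_const] at h
    refine (mul_eq_zero.1 ?_).resolve_left (hf.add_ne_zero hnt hD h0 hLW hz)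
    linear_combination h
  · have hk := hf.linearWeingarten hLW hz
    rw [← heq] at hk
    set k := normalCurvature (s.x ∘ e.symm) (s.n ∘ e.symm) a z with hk'
    -- The equation `κ = k` is stated through the shape operator on `D`, so that it is independent
    -- of the chart and can be propagated over `M`.
    have hall : ∀ p, ∀ Y ∈ D p, s.shapeOperator p Y = k • Y := by
      refine forall_of_locally (fun p => ?_) ((hf.shapeOperator_iff z hz k).2 hk')
      obtain ⟨e', a', b', hp, -, hf'⟩ := hD.exists_isAdaptedFrame p
      obtain ⟨ε, hε, hball⟩ := Metric.mem_nhds_iff.1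
        (e'.open_target.mem_nhds (e'.map_source hp))
      refine ⟨e'.source ∩ e' ⁻¹' Metric.ball (e' p) ε, Filter.inter_mem
        (e'.open_source.mem_nhds hp) ((e'.continuousAt hp).preimage_mem_nhds
          (Metric.ball_mem_nhds _ hε)), ?_⟩
      rintro ⟨q, hq, hqk⟩ q' hq'
      have iff : ∀ q ∈ e'.source, (∀ Y ∈ D q, s.shapeOperator q Y = k • Y) ↔
          k = normalCurvature (s.x ∘ e'.symm) (s.n ∘ e'.symm) a' (e' q) := by
        intro q hq
        have := hf'.shapeOperator_iff (e' q) (e'.map_source hq) k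
        rwa [e'.left_inv hq] at this
      rw [iff _ hq'.1]
      exact (hf'.normalCurvature_eq_of_umbilic hnt hD h0 hLW (by linear_combination hk)
        (convex_ball (e' p) ε) hball hq.2 hq'.2 ((iff _ hq.1).1 hqk).symm).symm
    refine hnt ⟨k, fun p => ?_⟩
    obtain ⟨e', a', b', hp, -, hf'⟩ := hD.exists_isAdaptedFrame p
    have h1 := hf'.shapeOperator_iff (e' p) (e'.map_source hp) k
    have h2 := hf'.isPrincipalCurvature_a (e' p) (e'.map_source hp)
    rw [e'.left_inv hp] at h1 h2
    rwa [h1.1 (hall p)]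

/-- All leaves are parallels with respect to a common axis. -/
theorem IsCircularCurvatureLineFamily.exists_axis [ConnectedSpace M] (hnt : ¬ s.IsTubular)
    (hD : IsCircularCurvatureLineFamily s D) (hLW : s.IsLinearWeingarten) :
    ∃ o w : E3, ‖w‖ = 1 ∧ ∀ p, (∀ Y ∈ D p, ⟪w, differential s.x p Y⟫ = 0) ∧
      (∀ Y ∈ D p, ⟪s.x p - o, differential s.x p Y⟫ = 0) ∧ ∀ t : ℝ, s.x p - o ≠ t • w := by
  have hloc : ∀ p, ∃ V ∈ nhds p, IsOpen V ∧ ∃ o w : E3, ‖w‖ = 1 ∧ ∀ q ∈ V,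
      ((∀ Y ∈ D q, ⟪w, differential s.x q Y⟫ = 0) ∧
      (∀ Y ∈ D q, ⟪s.x q - o, differential s.x q Y⟫ = 0) ∧ ∀ t : ℝ, s.x q - o ≠ t • w) ∧
      ∀ o' w' : E3, ‖w'‖ = 1 → (∀ᶠ q in nhds q, (∀ Y ∈ D q, ⟪w', differential s.x q Y⟫ = 0) ∧
      (∀ Y ∈ D q, ⟪s.x q - o', differential s.x q Y⟫ = 0) ∧ ∀ t : ℝ, s.x q - o' ≠ t • w') →
      (w' = w ∨ w' = -w) ∧ ∃ t : ℝ, o' = o + t • w := by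
    intro p
    obtain ⟨e, a, b, hp, -, hf⟩ := hD.exists_isAdaptedFrame p
    obtain ⟨ε, hε, hball⟩ := Metric.mem_nhds_iff.1 (e.open_target.mem_nhds (e.map_source hp))
    obtain ⟨o, w, hw, h⟩ := ((hf.isRotational hnt hD hLW).mono hball Metric.isOpen_ball).exists_axis
      (convex_ball (e p) ε).isPreconnected ⟨_, Metric.mem_ball_self hε⟩
    have hVo : IsOpen (e.source ∩ e ⁻¹' Metric.ball (e p) ε) :=
      e.isOpen_inter_preimage Metric.isOpen_ball
    refine ⟨_, hVo.mem_nhds ⟨hp, Metric.mem_ball_self hε⟩, hVo, o, w, hw, fun q hq => ?_⟩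
    obtain ⟨h1, h2, h3, h4⟩ := h (e q) hq.2
    have iff := hf.inner_iff (e q) (e.map_source hq.1)
    have hxq : (s.x ∘ e.symm) (e q) = s.x q := by simp [e.left_inv hq.1]
    rw [e.left_inv hq.1] at iff
    rw [hxq] at h2 h3
    refine ⟨⟨(iff w).2 h1, (iff _).2 h2, h3⟩, fun o' w' hw' hev => h4 o' w' hw' ?_⟩
    filter_upwards [(e.tendsto_symm hq.1).eventually hev,
      e.open_target.mem_nhds (e.map_source hq.1)] with y hy hyt
    exact ⟨(hf.inner_iff y hyt w').1 hy.1, (hf.inner_iff y hyt _).1 hy.2.1⟩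
  obtain ⟨p₀⟩ := (inferInstance : Nonempty M)
  obtain ⟨V, hV, hVo, o, w, hw, h⟩ := hloc p₀
  refine ⟨o, w, hw, fun p => ?_⟩
  -- The property is required on a neighbourhood, not only at `p`, because uniqueness of the axis
  -- uses derivatives.
  have hall := forall_of_locally (P := fun p => ∀ᶠ q in nhds p,
    (∀ Y ∈ D q, ⟪w, differential s.x q Y⟫ = 0) ∧
      (∀ Y ∈ D q, ⟪s.x q - o, differential s.x q Y⟫ = 0) ∧ ∀ t : ℝ, s.x q - o ≠ t • w)
    (fun p => ?_) (Filter.eventually_of_mem hV fun q hq => (h q hq).1) p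
  · exact hall.self_of_nhds
  · obtain ⟨V', hV', hVo', o', w', hw', h'⟩ := hloc p
    refine ⟨V', hV', ?_⟩
    rintro ⟨q, hq, hq'⟩ q₁ hq₁
    -- The two axes are the same line; the base point may be shifted along it and the direction
    -- reversed.
    obtain ⟨hww, t, rfl⟩ := (h' q hq).2 o w hw hq'
    refine Filter.eventually_of_mem (hVo'.mem_nhds hq₁) fun q₂ hq₂ => ?_
    obtain ⟨h1, h2, h3⟩ := (h' q₂ hq₂).1
    have h4 : ∀ Y ∈ D q₂, ⟪s.x q₂ - (o' + t • w'), differential s.x q₂ Y⟫ = 0 := fun Y hY => by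
      rw [← sub_sub, inner_sub_left, h2 Y hY, real_inner_smul_left, h1 Y hY, mul_zero, sub_zero]
    have h5 : ∀ c : ℝ, s.x q₂ - (o' + t • w') ≠ c • w' := fun c hc => h3 (c + t) (by
      rw [add_smul, ← hc]
      abel)
    rcases hww with rfl | rfl
    · exact ⟨h1, h4, h5⟩
    · refine ⟨fun Y hY => by rw [inner_neg_left, h1 Y hY, neg_zero], h4, fun c hc => h5 (-c) ?_⟩
      rw [hc, smul_neg, neg_smul]

end Global

/-! ### Cylindrical coordinates. -/

/-- A function on a rectangle with vanishing second partial derivative depends on the first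
coordinate only. -/
theorem eq_of_fderiv_single_one_eq_zero {z₀ : EuclideanSpace ℝ (Fin 2)} {ε : ℝ}
    {G : EuclideanSpace ℝ (Fin 2) → ℝ}
    (hd : ∀ z, |z 0 - z₀ 0| < ε → |z 1 - z₀ 1| < ε → DifferentiableAt ℝ G z ∧
      fderiv ℝ G z (EuclideanSpace.single 1 1) = 0) {z : EuclideanSpace ℝ (Fin 2)}
    (h0 : |z 0 - z₀ 0| < ε) (h1 : |z 1 - z₀ 1| < ε) : G z = G !₂[z 0, z₀ 1] := by
  set σ : EuclideanSpace ℝ (Fin 2) := !₂[z 0, z₀ 1] with hσ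
  have hline : ∀ t ∈ Metric.ball (0 : ℝ) ε, HasDerivAt
      (fun t : ℝ => G (σ + t • EuclideanSpace.single 1 1)) 0 t := by
    intro t ht
    obtain ⟨hG, hG'⟩ := hd (σ + t • EuclideanSpace.single 1 1) (by simpa [hσ] using h0)
      (by simpa [hσ] using ht)
    rw [← hG']
    exact hG.hasDerivAt_line
  have hε : 0 < ε := (abs_nonneg _).trans_lt h0
  have := Metric.isOpen_ball.is_const_of_deriv_eq_zero (convex_ball (0 : ℝ) ε).isPreconnected
    (fun t ht => (hline t ht).differentiableAt.differentiableWithinAt)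
    (fun t ht => (hline t ht).deriv) (x := z 1 - z₀ 1) (y := 0) (by simpa using h1)
    (Metric.mem_ball_self hε)
  have hz : σ + (z 1 - z₀ 1) • EuclideanSpace.single 1 1 = z := by
    ext i
    fin_cases i <;> simp [hσ]
  rwa [hz, zero_smul, add_zero] at this

theorem exists_rectangle_subset {U : Set (EuclideanSpace ℝ (Fin 2))} (hU : IsOpen U)
    {z₀ : EuclideanSpace ℝ (Fin 2)} (hz₀ : z₀ ∈ U) :
    ∃ ε > 0, ∀ z : EuclideanSpace ℝ (Fin 2), |z 0 - z₀ 0| < ε → |z 1 - z₀ 1| < ε → z ∈ U := by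
  obtain ⟨δ, hδ, hball⟩ := Metric.isOpen_iff.1 hU z₀ hz₀
  refine ⟨δ / 2, by positivity, fun z h0 h1 => hball ?_⟩
  rw [Metric.mem_ball, EuclideanSpace.dist_eq, Real.sqrt_lt' hδ, Fin.sum_univ_two, Real.dist_eq,
    Real.dist_eq]
  nlinarith [abs_nonneg (z 0 - z₀ 0), abs_nonneg (z 1 - z₀ 1)]

/-- A smooth choice of the angle of a nonvanishing complex function. -/
theorem exists_angle {E : Type*} [NormedAddCommGroup E] [NormedSpace ℝ E] {U : Set E}
    (hU : IsOpen U) {x y : E → ℝ} (hx : ContDiffOn ℝ ∞ x U) (hy : ContDiffOn ℝ ∞ y U) {z₀ : E}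
    (hz₀ : z₀ ∈ U) (hne : x z₀ ≠ 0 ∨ y z₀ ≠ 0) :
    ∃ V ⊆ U, IsOpen V ∧ z₀ ∈ V ∧ ∃ θ : E → ℝ, ContDiffOn ℝ ∞ θ V ∧ ∀ z ∈ V,
      x z = Real.sqrt (x z ^ 2 + y z ^ 2) * Real.cos (θ z) ∧
      y z = Real.sqrt (x z ^ 2 + y z ^ 2) * Real.sin (θ z) := by
  set Z : E → ℂ := fun z => (x z : ℂ) + (y z : ℂ) * Complex.I with hZ
  have hre : ∀ z, (Z z).re = x z := fun z => by simp [hZ]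
  have him : ∀ z, (Z z).im = y z := fun z => by simp [hZ]
  have hZs : ContDiffOn ℝ ∞ Z U := (Complex.ofRealCLM.contDiff.comp_contDiffOn hx).add
    ((Complex.ofRealCLM.contDiff.comp_contDiffOn hy).mul contDiffOn_const)
  have hZ0 : Z z₀ ≠ 0 := fun h => by
    rcases hne with h' | h'
    · exact h' (by rw [← hre, h, Complex.zero_re])
    · exact h' (by rw [← him, h, Complex.zero_im])
  have hnorm : ∀ z, ‖Z z‖ = Real.sqrt (x z ^ 2 + y z ^ 2) := fun z => by
    rw [Complex.norm_def, Complex.normSq_apply, hre, him, sq, sq]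
  -- Division by `Z z₀` moves the value at `z₀` to `1`, away from the branch cut of the logarithm.
  set ζ : E → ℂ := fun z => Z z / Z z₀ with hζ
  have hζs : ContDiffOn ℝ ∞ ζ U := hZs.div_const _
  refine ⟨U ∩ ζ ⁻¹' Complex.slitPlane, inter_subset_left,
    hζs.continuousOn.isOpen_inter_preimage hU Complex.isOpen_slitPlane, ⟨hz₀, ?_⟩,
    fun z => Complex.arg (Z z₀) + (Complex.log (ζ z)).im, ?_, fun z hz => ?_⟩
  · simp [hζ, hZ0]
  · intro z hz
    have h1 : ContDiffAt ℝ ∞ Complex.log (ζ z) := (Complex.contDiffAt_log hz.2).restrict_scalars ℝ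
    exact contDiffWithinAt_const.add (Complex.imCLM.contDiff.contDiffAt.comp_contDiffWithinAt z
      (h1.comp_contDiffWithinAt z ((hζs z hz.1).mono inter_subset_left)))
  · have h1 : Z z = (‖Z z‖ : ℂ) * Complex.exp
        (((Complex.arg (Z z₀) + (Complex.log (ζ z)).im : ℝ) : ℂ) * Complex.I) := by
      have h2 : Z z = Z z₀ * ζ z := by
        simp only [hζ]
        field_simp
      have h3 : ‖Z z‖ = ‖Z z₀‖ * ‖ζ z‖ := by rw [h2, norm_mul]
      rw [h3, Complex.log_im, Complex.ofReal_add, add_mul, Complex.exp_add, Complex.ofReal_mul,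
        mul_mul_mul_comm, Complex.norm_mul_exp_arg_mul_I, Complex.norm_mul_exp_arg_mul_I, ← h2]
    constructor
    · rw [← hnorm]
      have := congrArg Complex.re h1
      rwa [hre, Complex.re_ofReal_mul, Complex.exp_ofReal_mul_I_re] at this
    · rw [← hnorm]
      have := congrArg Complex.im h1
      rwa [him, Complex.im_ofReal_mul, Complex.exp_ofReal_mul_I_im] at this

/-- The inverse function theorem, with a smooth inverse on a whole neighbourhood. -/
theorem ContDiffOn.exists_openPartialHomeomorph {E : Type*} [NormedAddCommGroup E]
    [NormedSpace ℝ E] [FiniteDimensional ℝ E] {Φ : E → E} {V : Set E} (hV : IsOpen V)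
    (hΦ : ContDiffOn ℝ ∞ Φ V) (hinj : ∀ z ∈ V, Function.Injective (fderiv ℝ Φ z)) {z₀ : E}
    (hz₀ : z₀ ∈ V) :
    ∃ Ψ : OpenPartialHomeomorph E E, z₀ ∈ Ψ.source ∧ Ψ.source ⊆ V ∧ (∀ z, Ψ z = Φ z) ∧
      ContDiffOn ℝ ∞ Ψ Ψ.source ∧ ContDiffOn ℝ ∞ Ψ.symm Ψ.target := by
  have : CompleteSpace E := FiniteDimensional.complete ℝ E
  have hder : ∀ z ∈ V, ∃ A : E ≃L[ℝ] E, HasFDerivAt Φ (A : E →L[ℝ] E) z := by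
    intro z hz
    refine ⟨(LinearEquiv.ofInjectiveEndo (fderiv ℝ Φ z).toLinearMap
      (hinj z hz)).toContinuousLinearEquiv, ?_⟩
    convert (hΦ.differentiableAt_of_isOpen hV hz).hasFDerivAt using 1
    ext ξ
    rfl
  obtain ⟨A, hA⟩ := hder z₀ hz₀
  have hc := hΦ.contDiffAt (hV.mem_nhds hz₀)
  set Ψ := (hc.toOpenPartialHomeomorph Φ hA (by simp)).restrOpen V hV with hΨ
  have hcoe : ∀ z, Ψ z = Φ z := fun z => rfl
  have hcoe' : (Ψ : E → E) = Φ := rfl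
  have hsub : Ψ.source ⊆ V := inter_subset_right
  refine ⟨Ψ, ⟨hc.mem_toOpenPartialHomeomorph_source hA (by simp), hz₀⟩, hsub, hcoe,
    hΦ.mono hsub, fun y hy => ContDiffAt.contDiffWithinAt ?_⟩
  have hy' := hsub (Ψ.map_target hy)
  -- The derivative is invertible on all of `V`, so the inverse is smooth at every point of the
  -- target, not just at the image of `z₀`.
  obtain ⟨A', hA'⟩ := hder _ hy'
  exact Ψ.contDiffAt_symm hy hA' (hΦ.contDiffAt (hV.mem_nhds hy'))

/-- An immersed surface in whose coordinates the lines `u = const` are parallels admits cylindrical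
coordinates. -/
theorem exists_cylindrical_coordinates {U : Set (EuclideanSpace ℝ (Fin 2))}
    {X : EuclideanSpace ℝ (Fin 2) → E3} (hU : IsOpen U) (hX : ContDiffOn ℝ ∞ X U)
    (hinj : ∀ z ∈ U, Function.Injective (fderiv ℝ X z)) {o : E3} {f : OrthonormalBasis (Fin 3) ℝ E3}
    (hf : ∀ z ∈ U, ⟪f 2, fderiv ℝ X z (EuclideanSpace.single 1 1)⟫ = 0)
    (ho : ∀ z ∈ U, ⟪X z - o, fderiv ℝ X z (EuclideanSpace.single 1 1)⟫ = 0)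
    (hne : ∀ z ∈ U, ∀ t : ℝ, X z - o ≠ t • f 2) {z₀ : EuclideanSpace ℝ (Fin 2)} (hz₀ : z₀ ∈ U) :
    ∃ Ψ : OpenPartialHomeomorph (EuclideanSpace ℝ (Fin 2)) (EuclideanSpace ℝ (Fin 2)),
      z₀ ∈ Ψ.source ∧ Ψ.source ⊆ U ∧ ContDiffOn ℝ ∞ Ψ Ψ.source ∧
      ContDiffOn ℝ ∞ Ψ.symm Ψ.target ∧ ∃ (u₀ u₁ : ℝ) (r h : ℝ → ℝ),
        ContDiffOn ℝ ∞ r (Ioo u₀ u₁) ∧ ContDiffOn ℝ ∞ h (Ioo u₀ u₁) ∧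
        (∀ u ∈ Ioo u₀ u₁, 0 < r u) ∧ ∀ z ∈ Ψ.source, Ψ z 0 ∈ Ioo u₀ u₁ ∧
          X z = o + r (Ψ z 0) • (Real.cos (Ψ z 1) • f 0 + Real.sin (Ψ z 1) • f 1)
            + h (Ψ z 0) • f 2 := by
  have hcoord : ∀ i, ContDiffOn ℝ ∞ (fun z => ⟪X z - o, f i⟫) U := fun i =>
    (hX.sub contDiffOn_const).inner ℝ contDiffOn_const
  have hsum : ∀ z, X z = o + (⟪X z - o, f 0⟫ • f 0 + ⟪X z - o, f 1⟫ • f 1) +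
      ⟪X z - o, f 2⟫ • f 2 := by
    intro z
    have h := f.sum_repr' (X z - o)
    rw [Fin.sum_univ_three] at h
    rw [add_assoc, real_inner_comm, real_inner_comm (f 1), real_inner_comm (f 2), h]
    abel
  have hpos : ∀ z ∈ U, 0 < ⟪X z - o, f 0⟫ ^ 2 + ⟪X z - o, f 1⟫ ^ 2 := by
    intro z hz
    by_contra! hle
    have h0 : ⟪X z - o, f 0⟫ = 0 := by
      nlinarith [sq_nonneg ⟪X z - o, f 0⟫, sq_nonneg ⟪X z - o, f 1⟫]
    have h1 : ⟪X z - o, f 1⟫ = 0 := by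
      nlinarith [sq_nonneg ⟪X z - o, f 0⟫, sq_nonneg ⟪X z - o, f 1⟫]
    have h := hsum z
    rw [h0, h1, zero_smul, zero_smul, add_zero, add_zero] at h
    exact hne z hz _ (sub_eq_iff_eq_add'.2 h)
  have hρ : ContDiffOn ℝ ∞ (fun z => Real.sqrt (⟪X z - o, f 0⟫ ^ 2 + ⟪X z - o, f 1⟫ ^ 2)) U :=
    (((hcoord 0).pow 2).add ((hcoord 1).pow 2)).sqrt fun z hz => (hpos z hz).ne'
  have hder : ∀ i, ∀ z ∈ U, ∀ ξ, fderiv ℝ (fun z => ⟪X z - o, f i⟫) z ξ =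
      ⟪fderiv ℝ X z ξ, f i⟫ := by
    intro i z hz ξ
    rw [fderiv_inner_apply ℝ ((hX.differentiableAt_of_isOpen hU hz).sub_const o)
      (differentiableAt_const _), fderiv_sub_const]
    simp
  have hd2 : ∀ z ∈ U, fderiv ℝ (fun z => ⟪X z - o, f 2⟫) z (EuclideanSpace.single 1 1) = 0 :=
    fun z hz => by rw [hder 2 z hz, real_inner_comm, hf z hz]
  have hdρ : ∀ z ∈ U, fderiv ℝ (fun z => Real.sqrt (⟪X z - o, f 0⟫ ^ 2 + ⟪X z - o, f 1⟫ ^ 2)) z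
      (EuclideanSpace.single 1 1) = 0 := by
    intro z hz
    have h0 := (hcoord 0).differentiableAt_of_isOpen hU hz
    have h1 := (hcoord 1).differentiableAt_of_isOpen hU hz
    rw [fderiv_sqrt ((h0.fun_pow 2).fun_add (h1.fun_pow 2)) (hpos z hz).ne',
      fderiv_fun_add (h0.fun_pow 2) (h1.fun_pow 2), fderiv_fun_pow 2 h0, fderiv_fun_pow 2 h1]
    -- Half the `v`-derivative of the squared distance to the axis is `⟪X - o, X_v⟫` minus the `f 2`
    -- term, and both vanish.
    have h := ho z hz
    rw [← f.sum_inner_mul_inner, Fin.sum_univ_three, hf z hz] at h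
    simp only [smul_apply, add_apply, hder _ z hz,
      smul_eq_mul, real_inner_comm]
    rw [mul_eq_zero]
    right
    norm_num
    linear_combination 2 * h
  obtain ⟨ε, hε, hrect⟩ := exists_rectangle_subset hU hz₀
  set R : Set (EuclideanSpace ℝ (Fin 2)) := {z | |z 0 - z₀ 0| < ε ∧ |z 1 - z₀ 1| < ε} with hR
  have hRU : R ⊆ U := fun z hz => hrect z hz.1 hz.2
  have hRo : IsOpen R := by
    have hcont : ∀ i, Continuous fun z : EuclideanSpace ℝ (Fin 2) => |z i - z₀ i| := fun i => by
      fun_prop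
    exact (isOpen_lt (hcont 0) continuous_const).inter (isOpen_lt (hcont 1) continuous_const)
  have hz₀R : z₀ ∈ R := by simp [hR, hε]
  obtain ⟨V, hVR, hV, hz₀V, θ, hθ, hxy⟩ := exists_angle hRo ((hcoord 0).mono hRU)
    ((hcoord 1).mono hRU) hz₀R (by
      by_contra! h
      have := hpos z₀ hz₀
      rw [h.1, h.2] at this
      simp at this)
  have hXV : ∀ z ∈ V, X z = o + Real.sqrt (⟪X z - o, f 0⟫ ^ 2 + ⟪X z - o, f 1⟫ ^ 2) •
      (Real.cos (θ z) • f 0 + Real.sin (θ z) • f 1) + ⟪X z - o, f 2⟫ • f 2 := by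
    intro z hz
    rw [smul_add, smul_smul, smul_smul, ← (hxy z hz).1, ← (hxy z hz).2]
    exact hsum z
  set Φ : EuclideanSpace ℝ (Fin 2) → EuclideanSpace ℝ (Fin 2) := fun z => !₂[z 0, θ z] with hΦ
  have hΦs : ContDiffOn ℝ ∞ Φ V := by
    rw [contDiffOn_euclidean]
    intro i
    fin_cases i
    · exact (EuclideanSpace.proj (𝕜 := ℝ) (0 : Fin 2)).contDiff.contDiffOn
    · exact hθ
  have hΦd : ∀ z ∈ V, ∀ ξ, fderiv ℝ Φ z ξ 0 = ξ 0 ∧ fderiv ℝ Φ z ξ 1 = fderiv ℝ θ z ξ := by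
    intro z hz ξ
    have h : ∀ i : Fin 2, HasFDerivAt (fun z => Φ z i)
        ((EuclideanSpace.proj (𝕜 := ℝ) i).comp (fderiv ℝ Φ z)) z := fun i =>
      (EuclideanSpace.proj (𝕜 := ℝ) i).hasFDerivAt.comp z
        (hΦs.differentiableAt_of_isOpen hV hz).hasFDerivAt
    constructor
    · exact DFunLike.congr_fun ((h 0).unique
        (EuclideanSpace.proj (𝕜 := ℝ) (0 : Fin 2)).hasFDerivAt) ξ
    · exact DFunLike.congr_fun ((h 1).unique
        (hθ.differentiableAt_of_isOpen hV hz).hasFDerivAt) ξ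
  -- A kernel vector of `dΦ` is a multiple of `∂_v` that annihilates `dθ`. Radius and height are
  -- stationary along `∂_v` too, so `dX` kills it, and `X` is an immersion.
  have hΦinj : ∀ z ∈ V, Function.Injective (fderiv ℝ Φ z) := by
    intro z hz
    have hzU := hRU (hVR hz)
    rw [injective_iff_map_eq_zero]
    intro ξ hξ
    obtain ⟨h0, h1⟩ := hΦd z hz ξ
    rw [hξ] at h0 h1
    have hξ1 : ξ = ξ 1 • EuclideanSpace.single 1 1 := by
      ext i
      fin_cases i
      · simpa using h0.symm
      · simp
    have line : ∀ G : EuclideanSpace ℝ (Fin 2) → ℝ, DifferentiableAt ℝ G z →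
        fderiv ℝ G z ξ = 0 → HasDerivAt (fun t : ℝ => G (z + t • ξ)) 0 0 := by
      intro G hG h
      have := DifferentiableAt.hasDerivAt_line (f := G) (z := z) (e := ξ) (t := 0) (by simpa)
      simpa [h] using this
    have l1 := line _ (hρ.differentiableAt_of_isOpen hU hzU)
      (by rw [hξ1, map_smul, hdρ z hzU, smul_zero])
    have l2 := line _ ((hcoord 2).differentiableAt_of_isOpen hU hzU)
      (by rw [hξ1, map_smul, hd2 z hzU, smul_zero])
    have l3 := line _ (hθ.differentiableAt_of_isOpen hV hz) h1.symm
    have l4 := ((l1.smul ((l3.cos.smul_const (f 0)).add (l3.sin.smul_const (f 1)))).const_add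
      o).add (l2.smul_const (f 2))
    have l5 := l4.congr_of_eventuallyEq (f₁ := fun t : ℝ => X (z + t • ξ))
      (((tendsto_line z ξ).eventually (hV.mem_nhds hz)).mono fun t ht => hXV _ ht)
    have l6 := DifferentiableAt.hasDerivAt_line (f := X) (z := z) (e := ξ) (t := 0)
      (by simpa using hX.differentiableAt_of_isOpen hU hzU)
    have l7 := l6.unique l5
    rw [zero_smul, add_zero] at l7
    refine (injective_iff_map_eq_zero _).1 (hinj z hzU) ξ (l7.trans ?_)
    simp
  obtain ⟨Ψ, hΨ0, hΨV, hΨ, hΨs, hΨs'⟩ := hΦs.exists_openPartialHomeomorph hV hΦinj hz₀V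
  -- The profile curve is read off on the transversal `v = z₀ 1` of the rectangle.
  have hσ : ∀ u ∈ Ioo (z₀ 0 - ε) (z₀ 0 + ε), !₂[u, z₀ 1] ∈ U := fun u hu =>
    hRU (by simpa [hR, hε, abs_lt] using ⟨by linarith [hu.1], by linarith [hu.2]⟩)
  have hσs : ContDiff ℝ ∞ (fun u : ℝ => (!₂[u, z₀ 1] : EuclideanSpace ℝ (Fin 2))) := by
    rw [contDiff_euclidean]
    intro i
    fin_cases i
    · exact contDiff_id
    · exact contDiff_const
  refine ⟨Ψ, hΨ0, hΨV.trans (hVR.trans hRU), hΨs, hΨs', z₀ 0 - ε, z₀ 0 + ε, _, _,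
    hρ.comp hσs.contDiffOn hσ, (hcoord 2).comp hσs.contDiffOn hσ,
    fun u hu => Real.sqrt_pos.2 (hpos _ (hσ u hu)), fun z hz => ?_⟩
  have hzV := hΨV hz
  have hzR := hVR hzV
  have e0 : Ψ z 0 = z 0 := by rw [hΨ]; rfl
  have e1 : Ψ z 1 = θ z := by rw [hΨ]; rfl
  rw [e0, e1]
  refine ⟨?_, ?_⟩
  · have := abs_lt.1 hzR.1
    exact ⟨by linarith, by linarith⟩
  · have hr := eq_of_fderiv_single_one_eq_zero (z₀ := z₀) (ε := ε) (fun z h0 h1 =>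
      ⟨hρ.differentiableAt_of_isOpen hU (hrect z h0 h1), hdρ z (hrect z h0 h1)⟩) hzR.1 hzR.2
    have hh := eq_of_fderiv_single_one_eq_zero (z₀ := z₀) (ε := ε) (fun z h0 h1 =>
      ⟨(hcoord 2).differentiableAt_of_isOpen hU (hrect z h0 h1), hd2 z (hrect z h0 h1)⟩)
      hzR.1 hzR.2
    refine (hXV z hzV).trans ?_
    rw [hr, hh]
    rfl

/-! ### Surface of revolution and parallels. -/

section Parallels

variable {M : Type*} [TopologicalSpace M] [ChartedSpace (EuclideanSpace ℝ (Fin 2)) M]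

theorem OpenPartialHomeomorph.trans_mem_maximalAtlas [IsManifold (𝓡 2) ∞ M]
    {e : OpenPartialHomeomorph M (EuclideanSpace ℝ (Fin 2))}
    (he : e ∈ IsManifold.maximalAtlas (𝓡 2) ∞ M)
    {Ψ : OpenPartialHomeomorph (EuclideanSpace ℝ (Fin 2)) (EuclideanSpace ℝ (Fin 2))}
    (h : ContDiffOn ℝ ∞ Ψ Ψ.source) (h' : ContDiffOn ℝ ∞ Ψ.symm Ψ.target) :
    e.trans Ψ ∈ IsManifold.maximalAtlas (𝓡 2) ∞ M := by
  refine OpenPartialHomeomorph.mem_maximalAtlas_of_contMDiffOn _ ?_ ?_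
  · rw [OpenPartialHomeomorph.trans_source]
    exact h.contMDiffOn.comp ((contMDiffOn_of_mem_maximalAtlas he).mono inter_subset_left)
      fun q hq => hq.2
  · rw [OpenPartialHomeomorph.trans_target]
    exact (contMDiffOn_symm_of_mem_maximalAtlas he).comp (h'.contMDiffOn.mono inter_subset_left)
      fun q hq => hq.2

theorem isSurfaceOfRevolutionAbout_of_parallels [IsManifold (𝓡 2) ∞ M] {s : SurfaceInSpace M}
    {D : ∀ p : M, Submodule ℝ (TangentSpace (𝓡 2) p)} (hfol : IsFoliation D) {o : E3}
    {f : OrthonormalBasis (Fin 3) ℝ E3}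
    (h : ∀ p, (∀ Y ∈ D p, ⟪f 2, differential s.x p Y⟫ = 0) ∧
      (∀ Y ∈ D p, ⟪s.x p - o, differential s.x p Y⟫ = 0) ∧ ∀ t : ℝ, s.x p - o ≠ t • f 2) :
    IsSurfaceOfRevolutionAbout s o f := by
  intro p
  obtain ⟨e, he, hp, hfol⟩ := hfol p
  have hmem : ∀ z ∈ e.target, ∃ Y ∈ D (e.symm z), fderiv ℝ (s.x ∘ e.symm) z
      (EuclideanSpace.single 1 1) = differential s.x (e.symm z) Y := by
    intro z hz
    obtain ⟨L, -, hL, hL0⟩ := exists_chart_tangent_equiv he hz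
    refine ⟨_, ?_, hL _ s.smooth_x _⟩
    rw [hfol _ (e.map_target hz), hL0]
    have h0 : EuclideanSpace.single (1 : Fin 2) (1 : ℝ) 0 = 0 := by simp
    exact h0
  obtain ⟨Ψ, hp', hsub, hΨ, hΨ', u₀, u₁, r, k, hr, hk, hpos, hX⟩ := exists_cylindrical_coordinates
    (f := f) (o := o) e.open_target (contDiffOn_comp_symm he s.smooth_x) (fun z hz => by
      obtain ⟨L, -, hL, -⟩ := exists_chart_tangent_equiv he hz
      rw [funext (hL _ s.smooth_x)]
      exact (s.immersion _).comp L.injective)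
    (fun z hz => by
      obtain ⟨Y, hY, hXY⟩ := hmem z hz
      rw [hXY]
      exact (h _).1 Y hY)
    (fun z hz => by
      obtain ⟨Y, hY, hXY⟩ := hmem z hz
      rw [hXY]
      exact (h _).2.1 Y hY)
    (fun z hz => (h _).2.2) (e.map_source hp)
  refine ⟨e.trans Ψ, OpenPartialHomeomorph.trans_mem_maximalAtlas he hΨ hΨ', ?_,
    u₀, u₁, r, k, hr, hk, hpos, fun q hq => ?_⟩
  · rw [OpenPartialHomeomorph.trans_source]
    exact ⟨hp, hp'⟩
  · rw [OpenPartialHomeomorph.trans_source] at hq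
    have := hX (e q) hq.2
    rwa [Function.comp_apply, e.left_inv hq.1] at this

/-- Height along the axis and distance to the axis point at that height both have zero derivative
along a leaf. The radius is positive because the surface misses the axis. -/
theorem IsLeafArc.mem_parallel {s : SurfaceInSpace M}
    {D : ∀ p : M, Submodule ℝ (TangentSpace (𝓡 2) p)} {o w : E3} (hw : ‖w‖ = 1)
    (h : ∀ p, (∀ Y ∈ D p, ⟪w, differential s.x p Y⟫ = 0) ∧
      (∀ Y ∈ D p, ⟪s.x p - o, differential s.x p Y⟫ = 0) ∧ ∀ t : ℝ, s.x p - o ≠ t • w)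
    {γ : ℝ → M} {t₀ t₁ : ℝ} (hγ : IsLeafArc D γ t₀ t₁) :
    ∃ (k r : ℝ), 0 < r ∧ ∀ t ∈ Ioo t₀ t₁, s.x (γ t) ∈ circleInSpace (o + k • w) w r := by
  rcases (Ioo t₀ t₁).eq_empty_or_nonempty with hemp | ⟨t', ht'⟩
  -- An empty arc has no base point, and any circle serves.
  · exact ⟨0, 1, one_pos, by simp [hemp]⟩
  have hww : ⟪w, w⟫ = 1 := by rw [real_inner_self_eq_norm_sq, hw, one_pow]
  have hd : ∀ t ∈ Ioo t₀ t₁, ∃ Y ∈ D (γ t), HasDerivAt (fun t => s.x (γ t))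
      (differential s.x (γ t) Y) t := by
    intro t ht
    refine ⟨_, (hγ.2 t ht).2, ?_⟩
    have h1 : MDifferentiableAt 𝓘(ℝ, ℝ) (𝓡 2) γ t :=
      (hγ.1.contMDiffAt (isOpen_Ioo.mem_nhds ht)).mdifferentiableAt (by simp)
    have h2 : MDifferentiableAt (𝓡 2) 𝓘(ℝ, E3) s.x (γ t) :=
      (s.smooth_x _).mdifferentiableAt (by simp)
    have h3 := (h2.comp t h1).differentiableAt.hasDerivAt
    have h4 := mfderiv_comp t h2 h1
    rw [mfderiv_eq_fderiv] at h4
    have h5 : deriv (s.x ∘ γ) t =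
        differential s.x (γ t) (mfderiv 𝓘(ℝ, ℝ) (𝓡 2) γ t (1 : ℝ)) := by
      rw [← fderiv_apply_one_eq_deriv, h4]
      rfl
    rw [← h5]
    exact h3
  have hconst : ∀ φ : ℝ → ℝ, (∀ t ∈ Ioo t₀ t₁, HasDerivAt φ 0 t) →
      ∀ t ∈ Ioo t₀ t₁, φ t = φ t' := fun φ h t ht =>
    isOpen_Ioo.is_const_of_deriv_eq_zero isPreconnected_Ioo
      (fun t ht => (h t ht).differentiableAt.differentiableWithinAt)
      (fun t ht => (h t ht).deriv) ht ht'
  have hheight := hconst (fun t => ⟪s.x (γ t) - o, w⟫) fun t ht => by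
    obtain ⟨Y, hY, hYd⟩ := hd t ht
    have := (hYd.sub_const o).inner ℝ (hasDerivAt_const t w)
    rwa [real_inner_comm, real_inner_comm w, (h _).1 Y hY, inner_zero_left, zero_add] at this
  set k := ⟪s.x (γ t') - o, w⟫ with hk
  have hdist := hconst (fun t => ‖s.x (γ t) - (o + k • w)‖ ^ 2) fun t ht => by
    obtain ⟨Y, hY, hYd⟩ := hd t ht
    have := (hYd.sub_const (o + k • w)).norm_sq
    rwa [← sub_sub, inner_sub_left, (h _).2.1 Y hY, real_inner_smul_left, (h _).1 Y hY, mul_zero,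
      sub_zero, mul_zero] at this
  refine ⟨k, ‖s.x (γ t') - (o + k • w)‖, norm_pos_iff.2 fun h0 => ?_, fun t ht => ⟨?_, ?_⟩⟩
  · refine (h (γ t')).2.2 k ?_
    rwa [← sub_sub, sub_eq_zero] at h0
  · exact (pow_left_inj₀ (norm_nonneg _) (norm_nonneg _) two_ne_zero).1 (hdist t ht)
  · rw [← sub_sub, inner_sub_left, real_inner_smul_left, hww, hheight t ht, mul_one, sub_self]

end Parallels

theorem mainTheorem1 {M : Type*} [TopologicalSpace M]
    [ChartedSpace (EuclideanSpace ℝ (Fin 2)) M] [IsManifold (𝓡 2) ∞ M] [ConnectedSpace M]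
    (s : SurfaceInSpace M) (hLW : s.IsLinearWeingarten) (hnt : ¬ s.IsTubular)
    (D : ∀ p : M, Submodule ℝ (TangentSpace (𝓡 2) p))
    (hD : IsCircularCurvatureLineFamily s D) :
    ∃ (o : E3) (f : OrthonormalBasis (Fin 3) ℝ E3),
      IsSurfaceOfRevolutionAbout s o f ∧
      ∀ (γ : ℝ → M) (t₀ t₁ : ℝ), IsLeafArc D γ t₀ t₁ →
        ∃ (h r : ℝ), 0 < r ∧ ∀ t ∈ Ioo t₀ t₁, s.x (γ t) ∈ circleInSpace (o + h • f 2) (f 2) r := by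
  obtain ⟨o, w, hw, h⟩ := hD.exists_axis hnt hLW
  obtain ⟨f, hf⟩ : ∃ f : OrthonormalBasis (Fin 3) ℝ E3, f 2 = w := by
    obtain ⟨f, hf⟩ := Orthonormal.exists_orthonormalBasis_extension_of_card_eq (𝕜 := ℝ) (E := E3)
      (ι := Fin 3) (by simp) (v := fun _ => w) (s := {2})
      ⟨fun _ => hw, fun i j hij => absurd (Subsingleton.elim i j) hij⟩
    exact ⟨f, hf 2 rfl⟩
  subst hf
  exact ⟨o, f, isSurfaceOfRevolutionAbout_of_parallels hD.foliation h,
    fun γ t₀ t₁ hγ => hγ.mem_parallel hw h⟩
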